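/- Theorem (Beltrami). Let $M$ be a connected smooth two-dimensional manifold and let $g$ be a smooth Riemannian metric on $M$, with Levi-Civita connection $\nabla$. Call a smooth curve $\gamma\colon I\to M$, defined on an open interval $I\subseteq\mathbb R$ and with nowhere vanishing velocity $U$, an (unparameterised) geodesic of $g$ if its acceleration satisfies $\nabla_U U=fU$ for some smooth function $f\colon I\to\mathbb R$. Then the following are equivalent. 1. $g$ has constant curvature: there is a real number $K$ such that the Gaussian curvature of $g$ is $K$ at every point of $M$ or, what is the same, such that the Ricci tensor satisfies $R_{ab}=K g_{ab}$ on all of $M$. 2. Near each point the geodesics of $g$ become straight lines in suitable local coordinates: every $x\in M$ has an open neighbourhood $V$ with a smooth coordinate chart $\psi\colon V\to\mathbb R^2$ such that, for every geodesic $\gamma$ of $g$ that lies in $V$, the image $\psi\circ\gamma$ is contained in a straight line of $\mathbb R^2$. -/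

import Mathlib

open scoped Manifold ContDiff

noncomputable section

namespace Beltrami

/-- The coordinate plane. -/
abbrev Plane : Type := EuclideanSpace ℝ (Fin 2)

variable {M : Type*} [TopologicalSpace M] [ChartedSpace Plane M] [IsManifold (𝓡 2) ∞ M]

/-- Smooth Riemannian metrics on the surface `M`. -/
abbrev Metric (M : Type*) [TopologicalSpace M] [ChartedSpace Plane M]
    [IsManifold (𝓡 2) ∞ M] : Type _ :=
  Bundle.ContMDiffRiemannianMetric (𝓡 2) ∞ Plane (fun x : M => TangentSpace (𝓡 2) x)

/-- The standard basis vectors of the coordinate plane. -/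
abbrev basisVec (i : Fin 2) : Plane := EuclideanSpace.single i 1

/-- The partial derivative `∂ᵢ F` at the point `y` of the coordinate plane. -/
def partialDeriv (i : Fin 2) (F : Plane → ℝ) (y : Plane) : ℝ :=
  fderiv ℝ F y (basisVec i)

/-- The `i`-th coordinate vector field `∂/∂xⁱ` of the chart `e`, at the point `e.symm y` of `M`. -/
def coordVec (e : OpenPartialHomeomorph M Plane) (y : Plane) (i : Fin 2) :
    TangentSpace (𝓡 2) (e.symm y) :=
  mfderiv (𝓡 2) (𝓡 2) e.symm y (basisVec i)

/-- The matrix `gᵢⱼ` of the metric in the chart `e`, as a function of the coordinates `y`. -/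
def metricCoeff (g : Metric M) (e : OpenPartialHomeomorph M Plane) (y : Plane) :
    Matrix (Fin 2) (Fin 2) ℝ :=
  Matrix.of fun i j => g.inner (e.symm y) (coordVec e y i) (coordVec e y j)

/-- The Christoffel symbols of the Levi-Civita connection in the chart `e`:
`Γᵏᵢⱼ = ½ ∑ₗ gᵏˡ (∂ᵢ gⱼₗ + ∂ⱼ gᵢₗ - ∂ₗ gᵢⱼ)`; the upper index comes first. -/
def christoffel (g : Metric M) (e : OpenPartialHomeomorph M Plane) (k i j : Fin 2)
    (y : Plane) : ℝ :=
  (1 / 2 : ℝ) * ∑ l : Fin 2, (metricCoeff g e y)⁻¹ k l *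
    (partialDeriv i (fun z => metricCoeff g e z j l) y +
      partialDeriv j (fun z => metricCoeff g e z i l) y -
      partialDeriv l (fun z => metricCoeff g e z i j) y)

/-- The components `Rᵢⱼᵏₗ` of the curvature of the Levi-Civita connection in the chart `e`,
given by `(∇ᵢ∇ⱼ - ∇ⱼ∇ᵢ) Xᵏ = ∑ₗ Rᵢⱼᵏₗ Xˡ`. -/
def curvatureCoeff (g : Metric M) (e : OpenPartialHomeomorph M Plane) (i j k l : Fin 2)
    (y : Plane) : ℝ :=
  partialDeriv i (christoffel g e k j l) y - partialDeriv j (christoffel g e k i l) y +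
    ∑ m : Fin 2, (christoffel g e k i m y * christoffel g e m j l y -
      christoffel g e k j m y * christoffel g e m i l y)

/-- The components `Rⱼₗ = ∑ᵢ Rᵢⱼⁱₗ` of the Ricci tensor in the chart `e`. -/
def ricciCoeff (g : Metric M) (e : OpenPartialHomeomorph M Plane) (j l : Fin 2)
    (y : Plane) : ℝ :=
  ∑ i : Fin 2, curvatureCoeff g e i j i l y

/-- The Gaussian curvature of `g` at the point `x` equals `K`: the Ricci tensor at `x` is `K`
times the metric (in every smooth chart around `x`). -/
def HasGaussianCurvatureAt (g : Metric M) (K : ℝ) (x : M) : Prop :=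
  ∀ e ∈ IsManifold.maximalAtlas (𝓡 2) ∞ M, x ∈ e.source →
    ∀ i j : Fin 2, ricciCoeff g e i j (e x) = K * metricCoeff g e (e x) i j

/-- The metric `g` has constant (Gaussian) curvature. -/
def HasConstantCurvature (g : Metric M) : Prop :=
  ∃ K : ℝ, ∀ x : M, HasGaussianCurvatureAt g K x

/-- The `k`-th component of the velocity of the curve `γ` in the chart `e`. -/
def velocityCoeff (e : OpenPartialHomeomorph M Plane) (γ : ℝ → M) (k : Fin 2) (t : ℝ) : ℝ :=
  deriv (fun τ => e (γ τ) k) t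

/-- The `k`-th component of the acceleration of the curve `γ` (the covariant derivative of its
velocity along itself, for the Levi-Civita connection of `g`) in the chart `e`. -/
def accelerationCoeff (g : Metric M) (e : OpenPartialHomeomorph M Plane) (γ : ℝ → M)
    (k : Fin 2) (t : ℝ) : ℝ :=
  deriv (velocityCoeff e γ k) t + ∑ i : Fin 2, ∑ j : Fin 2,
    christoffel g e k i j (e (γ t)) * velocityCoeff e γ i t * velocityCoeff e γ j t

/-- The curve `γ`, restricted to the open interval `s`, is an unparameterised geodesic of `g`:
it is smooth with nowhere vanishing velocity `U`, and its acceleration is `f U` for some smooth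
function `f`. -/
structure IsUnparamGeodesicOn (g : Metric M) (γ : ℝ → M) (s : Set ℝ) : Prop where
  smooth : ContMDiffOn 𝓘(ℝ, ℝ) (𝓡 2) ∞ γ s
  regular : ∀ t ∈ s, mfderiv 𝓘(ℝ, ℝ) (𝓡 2) γ t ≠ 0
  accel : ∃ f : ℝ → ℝ, ContDiffOn ℝ ∞ f s ∧
    ∀ t ∈ s, ∀ e ∈ IsManifold.maximalAtlas (𝓡 2) ∞ M, γ t ∈ e.source →
      ∀ k : Fin 2, accelerationCoeff g e γ k t = f t * velocityCoeff e γ k t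

/-- In the local coordinates `e`, the geodesics of `g` become straight lines: every
unparameterised geodesic lying in the coordinate domain is mapped by `e` into a straight line. -/
def GeodesicsBecomeStraight (g : Metric M) (e : OpenPartialHomeomorph M Plane) : Prop :=
  ∀ (γ : ℝ → M) (s : Set ℝ), IsOpen s → IsPreconnected s →
    IsUnparamGeodesicOn g γ s → Set.MapsTo γ s e.source →
      Collinear ℝ ((fun t => e (γ t)) '' s)

end Beltrami

end

open scoped Manifold ContDiff

set_option linter.unusedSectionVars false

noncomputable section

namespace Beltrami

open Filter Topology

variable {M : Type*} [TopologicalSpace M] [ChartedSpace Plane M] [IsManifold (𝓡 2) ∞ M]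

/-! ### Partial derivatives in the coordinate plane. -/

section Calculus

variable {F G : Plane → ℝ} {y : Plane}

/-! From straight geodesics to constant curvature. Solving the geodesic equation gives a geodesic
through every point of the chart in every direction `v`. Since its image lies on a line, its
coordinate acceleration `-Γ(v, v)` is parallel to `v` for all `v`, which forces `Γᵏᵢⱼ = δᵏᵢ φⱼ + δᵏⱼ
φᵢ` (`projectivelyFlatAt_of_straight`). The equation `∇g = 0` then reads `∂ᵢ gⱼₗ = 2 φᵢ gⱼₗ + φⱼ gᵢₗ
+ φₗ gᵢⱼ`. Its integrability conditions say that `φ` is closed and that `φᵢ φⱼ - ∂ᵢ φⱼ = K gᵢⱼ` for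
a function `K` (`projective_integrability`), and `K` is the Gaussian curvature. Differentiating once
more and commuting second derivatives of `φ` gives `dK = 0` (`fderiv_projectiveCurvature`). So the
curvature is locally constant, hence constant by connectedness.

From constant curvature to straight geodesics. On the model surfaces the chart is the central
projection, a quotient of linear functions; their intrinsic analogues are the solutions of `∇²σ + K
g σ = 0`. As a first order linear system for `(σ, dσ)` this equation is flat exactly because `Ric =
K g` with `K` constant (`prolongation_flat`), so the Frobenius theorem for linear systems
(`exists_hasFDerivAt_of_flat`) yields local solutions with arbitrary value and differential at a
point. Take `σ₀, σ₁, σ₂` with 1-jets `1, dx⁰, dx¹` and the chart `(σ₁/σ₀, σ₂/σ₀)`. Along a curve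
with `∇_U U = f U` each `u = σ ∘ γ` solves the same equation `u'' = -K g(U, U) u + f u'`. Its
solutions form a space of dimension at most two, so some nontrivial `a σ₀ + b σ₁ + c σ₂` vanishes
along the curve; dividing by `σ₀` gives the equation of a line.

The curvature and geodesic conditions are required in all charts. The transformation laws of the
Christoffel symbols, the curvature and the acceleration reduce them to a single chart. -/

theorem partialDeriv_congr {i : Fin 2} (h : F =ᶠ[𝓝 y] G) :
    partialDeriv i F y = partialDeriv i G y := by
  simp only [partialDeriv, h.fderiv_eq]

theorem partialDeriv_const (i : Fin 2) (c : ℝ) : partialDeriv i (fun _ => c) y = 0 := by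
  simp [partialDeriv]

theorem partialDeriv_add {i : Fin 2} (hF : DifferentiableAt ℝ F y) (hG : DifferentiableAt ℝ G y) :
    partialDeriv i (fun z => F z + G z) y = partialDeriv i F y + partialDeriv i G y := by
  simp [partialDeriv, fderiv_fun_add hF hG]

theorem partialDeriv_sub {i : Fin 2} (hF : DifferentiableAt ℝ F y) (hG : DifferentiableAt ℝ G y) :
    partialDeriv i (fun z => F z - G z) y = partialDeriv i F y - partialDeriv i G y := by
  simp [partialDeriv, fderiv_fun_sub hF hG]

theorem partialDeriv_mul {i : Fin 2} (hF : DifferentiableAt ℝ F y) (hG : DifferentiableAt ℝ G y) :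
    partialDeriv i (fun z => F z * G z) y =
      partialDeriv i F y * G y + F y * partialDeriv i G y := by
  simp [partialDeriv, fderiv_fun_mul hF hG]; ring

theorem partialDeriv_const_mul {i : Fin 2} (c : ℝ) (hG : DifferentiableAt ℝ G y) :
    partialDeriv i (fun z => c * G z) y = c * partialDeriv i G y := by
  simp [partialDeriv, fderiv_const_mul hG]

theorem partialDeriv_sum {ι : Type*} (s : Finset ι) {H : ι → Plane → ℝ} {i : Fin 2}
    (hH : ∀ a ∈ s, DifferentiableAt ℝ (H a) y) :
    partialDeriv i (fun z => ∑ a ∈ s, H a z) y = ∑ a ∈ s, partialDeriv i (H a) y := by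
  simp [partialDeriv, fderiv_fun_sum hH]

theorem plane_eq_sum (v : Plane) : v = v 0 • basisVec 0 + v 1 • basisVec 1 := by
  ext i; fin_cases i <;> simp [basisVec]

theorem fderiv_eq_partialDeriv (v : Plane) :
    fderiv ℝ F y v = v 0 * partialDeriv 0 F y + v 1 * partialDeriv 1 F y := by
  conv_lhs => rw [plane_eq_sum v]
  simp [partialDeriv]

theorem contDiffAt_partialDeriv (hF : ContDiffAt ℝ ∞ F y) (i : Fin 2) :
    ContDiffAt ℝ ∞ (partialDeriv i F) y := by
  have : ContDiffAt ℝ ∞ (fderiv ℝ F) y := hF.fderiv_right (by simp)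
  exact this.clm_apply contDiffAt_const

theorem _root_.ContDiffAt.diff {E E' : Type*} [NormedAddCommGroup E] [NormedSpace ℝ E]
    [NormedAddCommGroup E'] [NormedSpace ℝ E'] {f : E → E'} {x : E} (h : ContDiffAt ℝ ∞ f x) :
    DifferentiableAt ℝ f x := h.differentiableAt (by simp)

theorem partialDeriv_comm (hF : ContDiffAt ℝ ∞ F y) (i j : Fin 2) :
    partialDeriv i (partialDeriv j F) y = partialDeriv j (partialDeriv i F) y := by
  have h : ContDiffAt ℝ ∞ (fderiv ℝ F) y := hF.fderiv_right (by simp)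
  have hs : IsSymmSndFDerivAt ℝ F y := (hF.of_le (m := 2) (WithTop.coe_le_coe.2 le_top)).isSymmSndFDerivAt
    (by simp)
  have key : ∀ a b : Fin 2, partialDeriv a (partialDeriv b F) y =
      fderiv ℝ (fderiv ℝ F) y (basisVec a) (basisVec b) := by
    intro a b
    have : HasFDerivAt (partialDeriv b F)
        (((ContinuousLinearMap.apply ℝ ℝ (basisVec b))).comp (fderiv ℝ (fderiv ℝ F) y)) y :=
      (ContinuousLinearMap.apply ℝ ℝ (basisVec b)).hasFDerivAt.comp y h.diff.hasFDerivAt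
    simp only [partialDeriv] at this ⊢
    rw [this.fderiv]; rfl
  rw [key, key]
  exact hs.eq _ _

theorem fderiv_coord {E : Type*} [NormedAddCommGroup E] [NormedSpace ℝ E] {Φ : E → Plane} {x : E}
    (hΦ : DifferentiableAt ℝ Φ x) (v : E) (a : Fin 2) :
    fderiv ℝ (fun z => Φ z a) x v = fderiv ℝ Φ x v a := by
  have : HasFDerivAt (fun z => Φ z a)
      ((EuclideanSpace.proj (𝕜 := ℝ) a : Plane →L[ℝ] ℝ).comp (fderiv ℝ Φ x)) x :=
    (EuclideanSpace.proj (𝕜 := ℝ) a : Plane →L[ℝ] ℝ).hasFDerivAt.comp x hΦ.hasFDerivAt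
  rw [this.fderiv]; rfl

theorem partialDeriv_comp {Φ : Plane → Plane} {i : Fin 2} (hF : DifferentiableAt ℝ F (Φ y))
    (hΦ : DifferentiableAt ℝ Φ y) :
    partialDeriv i (fun z => F (Φ z)) y =
      ∑ a : Fin 2, partialDeriv a F (Φ y) * partialDeriv i (fun z => Φ z a) y := by
  have h1 : fderiv ℝ (fun z => F (Φ z)) y = (fderiv ℝ F (Φ y)).comp (fderiv ℝ Φ y) :=
    fderiv_comp y hF hΦ
  simp only [partialDeriv, h1, ContinuousLinearMap.comp_apply, fderiv_coord hΦ, Fin.sum_univ_two]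
  rw [fderiv_eq_partialDeriv]; simp only [partialDeriv]; ring

theorem deriv_comp_curve {c : ℝ → Plane} {t : ℝ} (hF : DifferentiableAt ℝ F (c t))
    (hc : DifferentiableAt ℝ c t) :
    deriv (fun τ => F (c τ)) t = ∑ a : Fin 2, partialDeriv a F (c t) * deriv (fun τ => c τ a) t := by
  have h1 : fderiv ℝ (fun τ => F (c τ)) t = (fderiv ℝ F (c t)).comp (fderiv ℝ c t) :=
    fderiv_comp t hF hc
  have h2 : ∀ a : Fin 2, deriv (fun τ => c τ a) t = fderiv ℝ c t 1 a := by
    intro a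
    rw [← fderiv_apply_one_eq_deriv, fderiv_coord hc]
  rw [← fderiv_apply_one_eq_deriv, h1, ContinuousLinearMap.comp_apply, fderiv_eq_partialDeriv]
  simp only [Fin.sum_univ_two, h2]; ring

theorem contDiffAt_coord {E : Type*} [NormedAddCommGroup E] [NormedSpace ℝ E] {Φ : E → Plane} {x : E}
    (hΦ : ContDiffAt ℝ ∞ Φ x) (a : Fin 2) : ContDiffAt ℝ ∞ (fun z => Φ z a) x :=
  (EuclideanSpace.proj (𝕜 := ℝ) a : Plane →L[ℝ] ℝ).contDiff.contDiffAt.comp x hΦ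

end Calculus

/-! ### The metric in coordinates: smoothness, change of chart, positivity. -/

section Metric

variable (g : Metric M) {e : OpenPartialHomeomorph M Plane} {y : Plane}

/-- The coordinate field is the tangent map of `e.symm` applied to a constant section of the tangent
bundle of the plane. -/
theorem contMDiffAt_coordVec (he : e ∈ IsManifold.maximalAtlas (𝓡 2) ∞ M) (hy : y ∈ e.target)
    (i : Fin 2) :
    ContMDiffAt (𝓡 2) ((𝓡 2).prod (𝓡 2)) ∞
      (fun z => (⟨e.symm z, coordVec e z i⟩ : TangentBundle (𝓡 2) M)) y := by
  have h1 : ContMDiffOn (𝓡 2) (𝓡 2) ∞ e.symm e.target := contMDiffOn_symm_of_mem_maximalAtlas he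
  have h2 := h1.contMDiffOn_tangentMapWithin (m := ∞) (by simp) e.open_target.uniqueMDiffOn
  have h3 : ContMDiffAt (𝓡 2) ((𝓡 2).prod (𝓡 2)) ∞
      (fun z : Plane => (⟨z, basisVec i⟩ : TangentBundle (𝓡 2) Plane)) y :=
    contMDiffAt_vectorSpace_iff_contDiffAt.2 contDiffAt_const
  have h4 := (h2.contMDiffAt (x := (⟨y, basisVec i⟩ : TangentBundle (𝓡 2) Plane))
    ((e.open_target.preimage (FiberBundle.continuous_proj Plane _)).mem_nhds hy)).comp y h3
  refine h4.congr_of_eventuallyEq (eventually_of_mem (e.open_target.mem_nhds hy) fun z hz => ?_)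
  simp only [Function.comp_apply, tangentMapWithin, coordVec]
  rw [mfderivWithin_of_isOpen e.open_target hz]

theorem map_eq_sum_basisVec {E : Type*} [NormedAddCommGroup E] [NormedSpace ℝ E]
    (L : Plane →L[ℝ] E) (v : Plane) : L v = v 0 • L (basisVec 0) + v 1 • L (basisVec 1) := by
  conv_lhs => rw [plane_eq_sum v]
  rw [map_add, map_smul, map_smul]

/-- The coordinate vector fields, read in the model space of the tangent spaces. -/
def frameVec (e : OpenPartialHomeomorph M Plane) (y : Plane) (i : Fin 2) : Plane := coordVec e y i

/-- The metric as a bilinear form on the model space of each tangent space. -/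
def innerForm (x : M) : Plane →L[ℝ] Plane →L[ℝ] ℝ := g.inner x

theorem metricCoeff_apply (i j : Fin 2) :
    metricCoeff g e y i j = innerForm g (e.symm y) (frameVec e y i) (frameVec e y j) := rfl

theorem contDiffAt_metricCoeff (he : e ∈ IsManifold.maximalAtlas (𝓡 2) ∞ M) (hy : y ∈ e.target)
    (i j : Fin 2) : ContDiffAt ℝ ∞ (fun z => metricCoeff g e z i j) y := by
  rw [← contMDiffAt_iff_contDiffAt]
  have hb : ContMDiffAt (𝓡 2) (𝓡 2) ∞ e.symm y := contMDiffAt_symm_of_mem_maximalAtlas he hy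
  have : ContMDiffAt (𝓡 2) ((𝓡 2).prod 𝓘(ℝ)) ∞
      (fun m ↦ Bundle.TotalSpace.mk' ℝ (E := Bundle.Trivial M ℝ) (e.symm m)
        (g.inner (e.symm m) (coordVec e m i) (coordVec e m j))) y := by
    apply ContMDiffAt.clm_bundle_apply₂ (F₁ := Plane) (F₂ := Plane)
    · exact ContMDiffAt.comp y g.contMDiff.contMDiffAt hb
    · exact contMDiffAt_coordVec he hy i
    · exact contMDiffAt_coordVec he hy j
  rw [Bundle.contMDiffAt_totalSpace] at this
  exact this.2

theorem metricCoeff_symm (i j : Fin 2) : metricCoeff g e y i j = metricCoeff g e y j i :=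
  g.symm _ _ _

theorem contDiffAt_transition {e e' : OpenPartialHomeomorph M Plane}
    (he : e ∈ IsManifold.maximalAtlas (𝓡 2) ∞ M) (he' : e' ∈ IsManifold.maximalAtlas (𝓡 2) ∞ M)
    {y : Plane} (hy : y ∈ e.target) (hy' : e.symm y ∈ e'.source) :
    ContDiffAt ℝ ∞ (fun z => e' (e.symm z)) y := by
  rw [← contMDiffAt_iff_contDiffAt]
  exact (contMDiffAt_of_mem_maximalAtlas he' hy').comp y (contMDiffAt_symm_of_mem_maximalAtlas he hy)

theorem frameVec_eq {e e' : OpenPartialHomeomorph M Plane}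
    (he : e ∈ IsManifold.maximalAtlas (𝓡 2) ∞ M) (he' : e' ∈ IsManifold.maximalAtlas (𝓡 2) ∞ M)
    {y : Plane} (hy : y ∈ e.target) (hy' : e.symm y ∈ e'.source) (i : Fin 2) :
    frameVec e y i = ∑ a : Fin 2, partialDeriv i (fun z => e' (e.symm z) a) y •
      frameVec e' (e' (e.symm y)) a := by
  have hF := contDiffAt_transition he he' hy hy'
  have hev : e.symm =ᶠ[𝓝 y] fun z => e'.symm (e' (e.symm z)) := by
    have : ∀ᶠ z in 𝓝 y, e.symm z ∈ e'.source :=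
      (e.continuousAt_symm hy).eventually (e'.open_source.mem_nhds hy')
    exact this.mono fun z hz => (e'.left_inv hz).symm
  have h1 : mfderiv (𝓡 2) (𝓡 2) e.symm y =
      mfderiv (𝓡 2) (𝓡 2) (e'.symm ∘ fun z => e' (e.symm z)) y := hev.mfderiv_eq
  have h2 : MDifferentiableAt (𝓡 2) (𝓡 2) e'.symm (e' (e.symm y)) :=
    (contMDiffAt_symm_of_mem_maximalAtlas he' (e'.map_source hy')).mdifferentiableAt (by simp)
  have h3 : MDifferentiableAt (𝓡 2) (𝓡 2) (fun z => e' (e.symm z)) y :=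
    (contMDiffAt_iff_contDiffAt.2 hF).mdifferentiableAt (by simp)
  have h4 := mfderiv_comp y h2 h3
  obtain ⟨L, hL⟩ : ∃ L : Plane →L[ℝ] Plane,
    L = mfderiv (𝓡 2) (𝓡 2) e'.symm (e' (e.symm y)) := ⟨_, rfl⟩
  have h5 : frameVec e y i = L (fderiv ℝ (fun z => e' (e.symm z)) y (basisVec i)) := by
    rw [← mfderiv_eq_fderiv, hL]
    change mfderiv (𝓡 2) (𝓡 2) e.symm y (basisVec i) = _
    rw [h1, h4]
    rfl
  have h6 : ∀ a, frameVec e' (e' (e.symm y)) a = L (basisVec a) := fun a => by rw [hL]; rfl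
  rw [h5, map_eq_sum_basisVec, Fin.sum_univ_two, h6, h6]
  simp only [partialDeriv, fderiv_coord hF.diff]

/-- The differential of `e` is a left inverse of that of `e.symm`, so the latter keeps the standard
basis independent. -/
theorem frameVec_injective (he : e ∈ IsManifold.maximalAtlas (𝓡 2) ∞ M) (hy : y ∈ e.target)
    (a b : ℝ) (h : a • frameVec e y 0 + b • frameVec e y 1 = 0) :
    a = 0 ∧ b = 0 := by
  have h2 : MDifferentiableAt (𝓡 2) (𝓡 2) e (e.symm y) :=
    (contMDiffAt_of_mem_maximalAtlas he (e.map_target hy)).mdifferentiableAt (by simp)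
  have h3 : MDifferentiableAt (𝓡 2) (𝓡 2) e.symm y :=
    (contMDiffAt_symm_of_mem_maximalAtlas he hy).mdifferentiableAt (by simp)
  have h4 := mfderiv_comp y h2 h3
  have hev : (e ∘ e.symm) =ᶠ[𝓝 y] id :=
    eventually_of_mem (e.open_target.mem_nhds hy) fun z hz => e.right_inv hz
  rw [hev.mfderiv_eq, mfderiv_id] at h4
  obtain ⟨L, hL⟩ : ∃ L : Plane →L[ℝ] Plane, L = mfderiv (𝓡 2) (𝓡 2) e.symm y := ⟨_, rfl⟩
  obtain ⟨L', hL'⟩ : ∃ L' : Plane →L[ℝ] Plane, L' = mfderiv (𝓡 2) (𝓡 2) e (e.symm y) := ⟨_, rfl⟩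
  have h5 : ∀ v : Plane, v = L' (L v) := fun v => by
    rw [hL, hL']; exact DFunLike.congr_fun h4 v
  have h6 : ∀ i, frameVec e y i = L (basisVec i) := fun i => by rw [hL]; rfl
  have h7 : a • (basisVec 0 : Plane) + b • basisVec 1 = 0 := by
    rw [h5 (a • (basisVec 0 : Plane) + b • basisVec 1), map_add, map_smul, map_smul, ← h6, ← h6, h,
      map_zero]
  refine ⟨?_, ?_⟩
  · simpa using congrArg (fun v : Plane => v 0) h7
  · simpa using congrArg (fun v : Plane => v 1) h7

theorem metricCoeff_transition {e e' : OpenPartialHomeomorph M Plane}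
    (he : e ∈ IsManifold.maximalAtlas (𝓡 2) ∞ M) (he' : e' ∈ IsManifold.maximalAtlas (𝓡 2) ∞ M)
    {y : Plane} (hy : y ∈ e.target) (hy' : e.symm y ∈ e'.source) (i j : Fin 2) :
    metricCoeff g e y i j = ∑ a : Fin 2, ∑ b : Fin 2,
      partialDeriv i (fun z => e' (e.symm z) a) y * partialDeriv j (fun z => e' (e.symm z) b) y *
        metricCoeff g e' (e' (e.symm y)) a b := by
  simp only [metricCoeff_apply]
  rw [frameVec_eq he he' hy hy' i, frameVec_eq he he' hy hy' j, e'.left_inv hy']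
  simp only [Fin.sum_univ_two, map_add, map_smul, add_apply,
    smul_apply, smul_eq_mul]
  ring

theorem metricCoeff_pos (he : e ∈ IsManifold.maximalAtlas (𝓡 2) ∞ M) (hy : y ∈ e.target)
    (a b : ℝ) (h : a ≠ 0 ∨ b ≠ 0) :
    0 < a ^ 2 * metricCoeff g e y 0 0 + 2 * a * b * metricCoeff g e y 0 1 +
      b ^ 2 * metricCoeff g e y 1 1 := by
  have hv : a • frameVec e y 0 + b • frameVec e y 1 ≠ 0 := by
    intro h0
    have := frameVec_injective he hy a b h0
    tauto
  have := g.pos (e.symm y) _ hv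
  change (0 : ℝ) < innerForm g (e.symm y) (a • frameVec e y 0 + b • frameVec e y 1)
    (a • frameVec e y 0 + b • frameVec e y 1) at this
  simp only [map_add, map_smul, add_apply,
    smul_apply, smul_eq_mul, ← metricCoeff_apply] at this
  rw [metricCoeff_symm g 1 0] at this
  linarith

theorem metricCoeff_zero_zero_pos (he : e ∈ IsManifold.maximalAtlas (𝓡 2) ∞ M)
    (hy : y ∈ e.target) : 0 < metricCoeff g e y 0 0 := by
  simpa using metricCoeff_pos g he hy 1 0 (by simp)

theorem det_metricCoeff_pos (he : e ∈ IsManifold.maximalAtlas (𝓡 2) ∞ M) (hy : y ∈ e.target) :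
    0 < metricCoeff g e y 0 0 * metricCoeff g e y 1 1 - metricCoeff g e y 0 1 ^ 2 := by
  have h0 := metricCoeff_zero_zero_pos g he hy
  -- On the vector `(-g₀₁, g₀₀)` the quadratic form takes the value `g₀₀ · det g`.
  have := metricCoeff_pos g he hy (- metricCoeff g e y 0 1) (metricCoeff g e y 0 0)
    (Or.inr h0.ne')
  have h2 : 0 < metricCoeff g e y 0 0 *
      (metricCoeff g e y 0 0 * metricCoeff g e y 1 1 - metricCoeff g e y 0 1 ^ 2) := by
    linarith
  exact pos_of_mul_pos_right h2 h0.le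

end Metric

/-! ### Christoffel symbols: smoothness, metric compatibility, uniqueness. -/

section Christoffel

theorem eq_of_lin_comb_eq {p q r s a b a' b' : ℝ} (hd : p * s - q * r ≠ 0)
    (h0 : p * a + q * b = p * a' + q * b') (h1 : r * a + s * b = r * a' + s * b') :
    a = a' ∧ b = b' := by
  constructor
  · exact mul_left_cancel₀ hd (by linear_combination s * h0 - q * h1)
  · exact mul_left_cancel₀ hd (by linear_combination p * h1 - r * h0)

variable (g : Metric M) {e : OpenPartialHomeomorph M Plane} {y : Plane}

theorem inv_metricCoeff (e : OpenPartialHomeomorph M Plane) (y : Plane) (k l : Fin 2) :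
    (metricCoeff g e y)⁻¹ k l =
      (metricCoeff g e y 0 0 * metricCoeff g e y 1 1 - metricCoeff g e y 0 1 ^ 2)⁻¹ *
        !![metricCoeff g e y 1 1, - metricCoeff g e y 0 1;
          - metricCoeff g e y 0 1, metricCoeff g e y 0 0] k l := by
  rw [Matrix.inv_def, Matrix.det_fin_two, Matrix.adjugate_fin_two, Ring.inverse_eq_inv',
    metricCoeff_symm g 1 0, pow_two, Matrix.smul_apply, smul_eq_mul]

theorem contDiffAt_inv_metricCoeff (he : e ∈ IsManifold.maximalAtlas (𝓡 2) ∞ M)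
    (hy : y ∈ e.target) (k l : Fin 2) :
    ContDiffAt ℝ ∞ (fun z => (metricCoeff g e z)⁻¹ k l) y := by
  have h := contDiffAt_metricCoeff g he hy
  have hd := (det_metricCoeff_pos g he hy).ne'
  simp only [inv_metricCoeff]
  have hD : ContDiffAt ℝ ∞ (fun y => (metricCoeff g e y 0 0 * metricCoeff g e y 1 1 -
      metricCoeff g e y 0 1 ^ 2)⁻¹) y :=
    (((h 0 0).mul (h 1 1)).sub ((h 0 1).pow 2)).inv hd
  fin_cases k <;> fin_cases l
  · exact hD.mul (h 1 1)
  · exact hD.mul (h 0 1).neg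
  · exact hD.mul (h 0 1).neg
  · exact hD.mul (h 0 0)

theorem contDiffAt_christoffel (he : e ∈ IsManifold.maximalAtlas (𝓡 2) ∞ M)
    (hy : y ∈ e.target) (k i j : Fin 2) : ContDiffAt ℝ ∞ (christoffel g e k i j) y := by
  have h := contDiffAt_metricCoeff g he hy
  refine contDiffAt_const.mul (ContDiffAt.sum fun l _ => ?_)
  exact (contDiffAt_inv_metricCoeff g he hy k l).mul
    (((contDiffAt_partialDeriv (h j l) i).add (contDiffAt_partialDeriv (h i l) j)).sub
      (contDiffAt_partialDeriv (h i j) l))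

theorem christoffel_symm (k i j : Fin 2) : christoffel g e k i j y = christoffel g e k j i y := by
  simp only [christoffel, metricCoeff_symm g i j]
  congr 1
  exact Finset.sum_congr rfl fun l _ => by ring

theorem christoffel_lower (he : e ∈ IsManifold.maximalAtlas (𝓡 2) ∞ M)
    (hy : y ∈ e.target) (l i j : Fin 2) :
    metricCoeff g e y l 0 * christoffel g e 0 i j y +
      metricCoeff g e y l 1 * christoffel g e 1 i j y =
    1 / 2 * (partialDeriv i (fun z => metricCoeff g e z j l) y +
      partialDeriv j (fun z => metricCoeff g e z i l) y -
      partialDeriv l (fun z => metricCoeff g e z i j) y) := by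
  have hd := (det_metricCoeff_pos g he hy).ne'
  simp only [christoffel, inv_metricCoeff, Fin.sum_univ_two]
  generalize hD : metricCoeff g e y 0 0 * metricCoeff g e y 1 1 - metricCoeff g e y 0 1 ^ 2 = D at *
  fin_cases l
  · simp
    field_simp
    rw [← hD]; ring
  · simp [metricCoeff_symm g 1 0]
    field_simp
    rw [← hD]; ring

/-- This is `∇g = 0`: in the sum of two lowered Christoffel formulas all but one derivative of the
metric cancel. -/
theorem partialDeriv_metricCoeff (he : e ∈ IsManifold.maximalAtlas (𝓡 2) ∞ M)
    (hy : y ∈ e.target) (i j l : Fin 2) :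
    partialDeriv i (fun z => metricCoeff g e z j l) y =
      ∑ m : Fin 2, (christoffel g e m i j y * metricCoeff g e y m l +
        christoffel g e m i l y * metricCoeff g e y m j) := by
  have h1 := christoffel_lower g he hy l i j
  have h2 := christoffel_lower g he hy j i l
  have hs : ∀ a b c : Fin 2, partialDeriv a (fun z => metricCoeff g e z b c) y =
    partialDeriv a (fun z => metricCoeff g e z c b) y := fun a b c => by
      simp only [metricCoeff_symm g b c]
  rw [hs i l j] at h2
  simp only [Fin.sum_univ_two]
  rw [metricCoeff_symm g 0 l, metricCoeff_symm g 0 j, metricCoeff_symm g 1 l,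
    metricCoeff_symm g 1 j]
  linarith

/-- Uniqueness of the Levi-Civita connection: Koszul's formula recovers a symmetric metric
connection from the derivatives of the metric. -/
theorem eq_christoffel (he : e ∈ IsManifold.maximalAtlas (𝓡 2) ∞ M)
    (hy : y ∈ e.target) {C : Fin 2 → Fin 2 → Fin 2 → ℝ} (hsymm : ∀ k i j, C k i j = C k j i)
    (hC : ∀ i j l, partialDeriv i (fun z => metricCoeff g e z j l) y =
      ∑ m : Fin 2, (C m i j * metricCoeff g e y m l + C m i l * metricCoeff g e y m j))
    (k i j : Fin 2) : christoffel g e k i j y = C k i j := by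
  have hl : ∀ l, metricCoeff g e y l 0 * christoffel g e 0 i j y +
      metricCoeff g e y l 1 * christoffel g e 1 i j y =
      metricCoeff g e y l 0 * C 0 i j + metricCoeff g e y l 1 * C 1 i j := by
    intro l
    rw [christoffel_lower g he hy, hC, hC, hC]
    simp only [Fin.sum_univ_two]
    rw [hsymm 0 j i, hsymm 0 l i, hsymm 0 l j, hsymm 1 j i, hsymm 1 l i, hsymm 1 l j,
      metricCoeff_symm g l 0, metricCoeff_symm g l 1]
    ring
  have hd := (det_metricCoeff_pos g he hy).ne'
  have := eq_of_lin_comb_eq (by rw [metricCoeff_symm g 1 0, ← pow_two]; exact hd) (hl 0) (hl 1)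
  fin_cases k
  · exact this.1
  · exact this.2

end Christoffel

/-! ### Christoffel symbols under a change of chart. -/

section Transition

variable (g : Metric M) {e e' : OpenPartialHomeomorph M Plane} {y : Plane}

/-- The Jacobian matrix of the change of coordinates from `e` to `e'`. -/
def jacobian (e e' : OpenPartialHomeomorph M Plane) (a i : Fin 2) (y : Plane) : ℝ :=
  partialDeriv i (fun z => e' (e.symm z) a) y

theorem eventually_mem_transition (hy : y ∈ e.target) (hy' : e.symm y ∈ e'.source) :
    ∀ᶠ z in 𝓝 y, z ∈ e.target ∧ e.symm z ∈ e'.source :=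
  (eventually_of_mem (e.open_target.mem_nhds hy) fun _ h => h).and
    ((e.continuousAt_symm hy).eventually (e'.open_source.mem_nhds hy'))

theorem contDiffAt_jacobian (he : e ∈ IsManifold.maximalAtlas (𝓡 2) ∞ M)
    (he' : e' ∈ IsManifold.maximalAtlas (𝓡 2) ∞ M) (hy : y ∈ e.target)
    (hy' : e.symm y ∈ e'.source) (a i : Fin 2) : ContDiffAt ℝ ∞ (jacobian e e' a i) y :=
  contDiffAt_partialDeriv (contDiffAt_coord (contDiffAt_transition he he' hy hy') a) i

theorem jacobian_partialDeriv_comm (he : e ∈ IsManifold.maximalAtlas (𝓡 2) ∞ M)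
    (he' : e' ∈ IsManifold.maximalAtlas (𝓡 2) ∞ M) (hy : y ∈ e.target)
    (hy' : e.symm y ∈ e'.source) (a i j : Fin 2) :
    partialDeriv i (jacobian e e' a j) y = partialDeriv j (jacobian e e' a i) y :=
  partialDeriv_comm (contDiffAt_coord (contDiffAt_transition he he' hy hy') a) i j

theorem partialDeriv_comp_transition (he : e ∈ IsManifold.maximalAtlas (𝓡 2) ∞ M)
    (he' : e' ∈ IsManifold.maximalAtlas (𝓡 2) ∞ M) (hy : y ∈ e.target)
    (hy' : e.symm y ∈ e'.source) {H : Plane → ℝ} (hH : ContDiffAt ℝ ∞ H (e' (e.symm y)))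
    (i : Fin 2) :
    partialDeriv i (fun z => H (e' (e.symm z))) y =
      ∑ d : Fin 2, partialDeriv d H (e' (e.symm y)) * jacobian e e' d i y :=
  partialDeriv_comp hH.diff (contDiffAt_transition he he' hy hy').diff

theorem metricCoeff_eq_jacobian (he : e ∈ IsManifold.maximalAtlas (𝓡 2) ∞ M)
    (he' : e' ∈ IsManifold.maximalAtlas (𝓡 2) ∞ M) (hy : y ∈ e.target)
    (hy' : e.symm y ∈ e'.source) (i j : Fin 2) :
    metricCoeff g e y i j = ∑ a : Fin 2, ∑ b : Fin 2,
      jacobian e e' a i y * jacobian e e' b j y * metricCoeff g e' (e' (e.symm y)) a b :=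
  metricCoeff_transition g he he' hy hy' i j

/-- The metric law gives `det g = (det J)² det g'`, and the left side is positive. -/
theorem det_jacobian_ne_zero (g : Metric M) (he : e ∈ IsManifold.maximalAtlas (𝓡 2) ∞ M)
    (he' : e' ∈ IsManifold.maximalAtlas (𝓡 2) ∞ M) (hy : y ∈ e.target)
    (hy' : e.symm y ∈ e'.source) :
    jacobian e e' 0 0 y * jacobian e e' 1 1 y - jacobian e e' 0 1 y * jacobian e e' 1 0 y ≠ 0 := by
  intro h0
  have h := det_metricCoeff_pos g he hy
  simp only [metricCoeff_eq_jacobian g he he' hy hy', Fin.sum_univ_two] at h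
  rw [metricCoeff_symm g 1 0] at h
  refine h.ne' ?_
  linear_combination (jacobian e e' 0 0 y * jacobian e e' 1 1 y -
    jacobian e e' 0 1 y * jacobian e e' 1 0 y) *
    (metricCoeff g e' (e' (e.symm y)) 0 0 * metricCoeff g e' (e' (e.symm y)) 1 1 -
      metricCoeff g e' (e' (e.symm y)) 0 1 ^ 2) * h0

theorem contDiffAt_comp_transition (he : e ∈ IsManifold.maximalAtlas (𝓡 2) ∞ M)
    (he' : e' ∈ IsManifold.maximalAtlas (𝓡 2) ∞ M) (hy : y ∈ e.target)
    (hy' : e.symm y ∈ e'.source) {H : Plane → ℝ} (hH : ContDiffAt ℝ ∞ H (e' (e.symm y))) :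
    ContDiffAt ℝ ∞ (fun z => H (e' (e.symm z))) y :=
  hH.comp y (contDiffAt_transition he he' hy hy')

theorem partialDeriv_metricCoeff_transition (he : e ∈ IsManifold.maximalAtlas (𝓡 2) ∞ M)
    (he' : e' ∈ IsManifold.maximalAtlas (𝓡 2) ∞ M) (hy : y ∈ e.target)
    (hy' : e.symm y ∈ e'.source) (i j l : Fin 2) :
    partialDeriv i (fun z => metricCoeff g e z j l) y = ∑ a : Fin 2, ∑ b : Fin 2,
      ((partialDeriv i (jacobian e e' a j) y * jacobian e e' b l y +
        jacobian e e' a j y * partialDeriv i (jacobian e e' b l) y) *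
          metricCoeff g e' (e' (e.symm y)) a b +
      jacobian e e' a j y * jacobian e e' b l y *
        ∑ d : Fin 2, partialDeriv d (fun z => metricCoeff g e' z a b) (e' (e.symm y)) *
          jacobian e e' d i y) := by
  have hJ := contDiffAt_jacobian he he' hy hy'
  have hG : ∀ a b, ContDiffAt ℝ ∞ (fun z => metricCoeff g e' z a b) (e' (e.symm y)) :=
    contDiffAt_metricCoeff g he' (e'.map_source hy')
  have hG' := fun a b => contDiffAt_comp_transition he he' hy hy' (hG a b)
  have hev : (fun z => metricCoeff g e z j l) =ᶠ[𝓝 y] fun z => ∑ a : Fin 2, ∑ b : Fin 2,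
      jacobian e e' a j z * jacobian e e' b l z * metricCoeff g e' (e' (e.symm z)) a b :=
    (eventually_mem_transition hy hy').mono fun z hz =>
      metricCoeff_eq_jacobian g he he' hz.1 hz.2 j l
  rw [partialDeriv_congr hev, partialDeriv_sum _ fun a _ =>
    (ContDiffAt.sum fun b _ => ((hJ a j).mul (hJ b l)).mul (hG' a b)).diff]
  refine Finset.sum_congr rfl fun a _ => ?_
  rw [partialDeriv_sum _ fun b _ => (((hJ a j).mul (hJ b l)).mul (hG' a b)).diff]
  refine Finset.sum_congr rfl fun b _ => ?_
  rw [partialDeriv_mul ((hJ a j).mul (hJ b l)).diff (hG' a b).diff,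
    partialDeriv_mul (hJ a j).diff (hJ b l).diff,
    partialDeriv_comp_transition he he' hy hy' (hG a b)]

/-- The symbols that this law prescribes in the chart `e` are symmetric and compatible with the
metric, so `eq_christoffel` identifies them with the Christoffel symbols; no inverse metric has to
be transformed. -/
theorem christoffel_transition (he : e ∈ IsManifold.maximalAtlas (𝓡 2) ∞ M)
    (he' : e' ∈ IsManifold.maximalAtlas (𝓡 2) ∞ M) (hy : y ∈ e.target)
    (hy' : e.symm y ∈ e'.source) (c i j : Fin 2) :
    ∑ k : Fin 2, christoffel g e k i j y * jacobian e e' c k y =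
      partialDeriv i (jacobian e e' c j) y + ∑ a : Fin 2, ∑ b : Fin 2,
        christoffel g e' c a b (e' (e.symm y)) * jacobian e e' a i y * jacobian e e' b j y := by
  have hd := det_jacobian_ne_zero g he he' hy hy'
  obtain ⟨T, hT⟩ : ∃ T : Fin 2 → Fin 2 → Fin 2 → ℝ, ∀ c i j, T c i j =
    partialDeriv i (jacobian e e' c j) y + ∑ a : Fin 2, ∑ b : Fin 2,
      christoffel g e' c a b (e' (e.symm y)) * jacobian e e' a i y * jacobian e e' b j y :=
    ⟨_, fun _ _ _ => rfl⟩
  have hTs : ∀ c i j, T c i j = T c j i := by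
    intro c i j
    rw [hT, hT, jacobian_partialDeriv_comm he he' hy hy' c i j]
    simp only [Fin.sum_univ_two]
    rw [christoffel_symm g c 1 0]
    ring
  let D := jacobian e e' 0 0 y * jacobian e e' 1 1 y - jacobian e e' 0 1 y * jacobian e e' 1 0 y
  -- Cramer's rule for `J C = T`.
  let C : Fin 2 → Fin 2 → Fin 2 → ℝ := fun k i j =>
    ![D⁻¹ * (jacobian e e' 1 1 y * T 0 i j - jacobian e e' 0 1 y * T 1 i j),
      D⁻¹ * (jacobian e e' 0 0 y * T 1 i j - jacobian e e' 1 0 y * T 0 i j)] k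
  have hC : ∀ c i j, C 0 i j * jacobian e e' c 0 y + C 1 i j * jacobian e e' c 1 y = T c i j := by
    intro c i j
    refine mul_left_cancel₀ hd ?_
    have hDD : D * D⁻¹ = 1 := mul_inv_cancel₀ hd
    simp only [C, Matrix.cons_val_zero, Matrix.cons_val_one]
    change D * _ = D * _
    fin_cases c <;> simp only [Fin.zero_eta, Fin.mk_one] <;> simp only [D] at hDD ⊢
    · linear_combination (jacobian e e' 0 0 y * jacobian e e' 1 1 y -
        jacobian e e' 0 1 y * jacobian e e' 1 0 y) * T 0 i j * hDD
    · linear_combination (jacobian e e' 0 0 y * jacobian e e' 1 1 y -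
        jacobian e e' 0 1 y * jacobian e e' 1 0 y) * T 1 i j * hDD
  have hCs : ∀ k i j, C k i j = C k j i := by
    intro k i j
    simp only [C, hTs _ i j]
  have key : ∀ k i j, christoffel g e k i j y = C k i j := by
    refine fun k i j => eq_christoffel g he hy hCs (fun i j l => ?_) k i j
    rw [partialDeriv_metricCoeff_transition g he he' hy hy']
    simp only [partialDeriv_metricCoeff g he' (e'.map_source hy'),
      metricCoeff_eq_jacobian g he he' hy hy', Fin.sum_univ_two]
    have e0 := hC 0 i j
    have e1 := hC 1 i j
    have e2 := hC 0 i l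
    have e3 := hC 1 i l
    rw [hT] at e0 e1 e2 e3
    simp only [Fin.sum_univ_two] at e0 e1 e2 e3
    rw [metricCoeff_symm g 1 0]
    generalize metricCoeff g e' (e' (e.symm y)) 0 0 = g00 at *
    generalize metricCoeff g e' (e' (e.symm y)) 0 1 = g01 at *
    generalize metricCoeff g e' (e' (e.symm y)) 1 1 = g11 at *
    linear_combination -(jacobian e e' 0 l y * g00 + jacobian e e' 1 l y * g01) * e0 -
      (jacobian e e' 0 l y * g01 + jacobian e e' 1 l y * g11) * e1 -
      (jacobian e e' 0 j y * g00 + jacobian e e' 1 j y * g01) * e2 -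
      (jacobian e e' 0 j y * g01 + jacobian e e' 1 j y * g11) * e3
  rw [← hT, ← hC, Fin.sum_univ_two, key, key]

end Transition

/-! ### Curvature under a change of chart. -/

section CurvatureTransition

variable (g : Metric M) {e e' : OpenPartialHomeomorph M Plane} {y : Plane}

theorem partialDeriv_christoffel_transition (he : e ∈ IsManifold.maximalAtlas (𝓡 2) ∞ M)
    (he' : e' ∈ IsManifold.maximalAtlas (𝓡 2) ∞ M) (hy : y ∈ e.target)
    (hy' : e.symm y ∈ e'.source) (d c i j : Fin 2) :
    ∑ k : Fin 2, (partialDeriv d (christoffel g e k i j) y * jacobian e e' c k y +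
        christoffel g e k i j y * partialDeriv d (jacobian e e' c k) y) =
      partialDeriv d (partialDeriv i (jacobian e e' c j)) y + ∑ a : Fin 2, ∑ b : Fin 2,
        (((∑ m : Fin 2, partialDeriv m (christoffel g e' c a b) (e' (e.symm y)) *
            jacobian e e' m d y) * jacobian e e' a i y +
          christoffel g e' c a b (e' (e.symm y)) * partialDeriv d (jacobian e e' a i) y) *
            jacobian e e' b j y +
          christoffel g e' c a b (e' (e.symm y)) * jacobian e e' a i y *
            partialDeriv d (jacobian e e' b j) y) := by
  have hJ := contDiffAt_jacobian he he' hy hy'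
  have hΓ := contDiffAt_christoffel g he hy
  have hG : ∀ a b, ContDiffAt ℝ ∞ (christoffel g e' c a b) (e' (e.symm y)) :=
    contDiffAt_christoffel g he' (e'.map_source hy') c
  have hG' := fun a b => contDiffAt_comp_transition he he' hy hy' (hG a b)
  have hev : (fun z => ∑ k : Fin 2, christoffel g e k i j z * jacobian e e' c k z) =ᶠ[𝓝 y]
      fun z => partialDeriv i (jacobian e e' c j) z + ∑ a : Fin 2, ∑ b : Fin 2,
        christoffel g e' c a b (e' (e.symm z)) * jacobian e e' a i z * jacobian e e' b j z :=
    (eventually_mem_transition hy hy').mono fun z hz =>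
      christoffel_transition g he he' hz.1 hz.2 c i j
  have h := partialDeriv_congr (i := d) hev
  rw [partialDeriv_sum _ fun k _ => ((hΓ k i j).mul (hJ c k)).diff,
    partialDeriv_add (contDiffAt_partialDeriv (hJ c j) i).diff (ContDiffAt.sum fun a _ =>
      ContDiffAt.sum fun b _ => ((hG' a b).mul (hJ a i)).mul (hJ b j)).diff,
    partialDeriv_sum _ fun a _ => (ContDiffAt.sum fun b _ =>
      ((hG' a b).mul (hJ a i)).mul (hJ b j)).diff] at h
  rw [← Finset.sum_congr rfl fun k _ => partialDeriv_mul (hΓ k i j).diff (hJ c k).diff, h]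
  congr 1
  refine Finset.sum_congr rfl fun a _ => ?_
  rw [partialDeriv_sum _ fun b _ => (((hG' a b).mul (hJ a i)).mul (hJ b j)).diff]
  refine Finset.sum_congr rfl fun b _ => ?_
  rw [partialDeriv_mul ((hG' a b).mul (hJ a i)).diff (hJ b j).diff,
    partialDeriv_mul (hG' a b).diff (hJ a i).diff,
    partialDeriv_comp_transition he he' hy hy' (hG a b)]

/-- Antisymmetrising the differentiated Christoffel law cancels the third derivatives of the
transition map, and substituting the law itself removes the second derivatives. Curvature is
antisymmetric in its first two indices, so in dimension two the Jacobian factors of that pair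
collapse to `det J`. -/
theorem curvatureCoeff_transition (he : e ∈ IsManifold.maximalAtlas (𝓡 2) ∞ M)
    (he' : e' ∈ IsManifold.maximalAtlas (𝓡 2) ∞ M) (hy : y ∈ e.target)
    (hy' : e.symm y ∈ e'.source) (c j : Fin 2) :
    ∑ k : Fin 2, curvatureCoeff g e 0 1 k j y * jacobian e e' c k y =
      (jacobian e e' 0 0 y * jacobian e e' 1 1 y - jacobian e e' 0 1 y * jacobian e e' 1 0 y) *
      ∑ b : Fin 2, curvatureCoeff g e' 0 1 c b (e' (e.symm y)) * jacobian e e' b j y := by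
  have h0 := partialDeriv_christoffel_transition g he he' hy hy' 0 c 1 j
  have h1 := partialDeriv_christoffel_transition g he he' hy hy' 1 c 0 j
  rw [partialDeriv_comm (contDiffAt_jacobian he he' hy hy' c j) 1 0] at h1
  have hE := fun c i j => christoffel_transition g he he' hy hy' c i j
  have hs := fun a => jacobian_partialDeriv_comm he he' hy hy' a 1 0
  simp only [hs] at h0 h1
  have hS : christoffel g e' c 1 0 (e' (e.symm y)) = christoffel g e' c 0 1 (e' (e.symm y)) :=
    christoffel_symm g c 1 0
  have hS' : ∀ m c, partialDeriv m (christoffel g e' c 1 0) (e' (e.symm y)) =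
      partialDeriv m (christoffel g e' c 0 1) (e' (e.symm y)) := fun m c => by
    congr 1; ext z; exact christoffel_symm g c 1 0
  have e00 := hE c 0 0
  have e01 := hE c 0 1
  have e10 := hE c 1 0
  have e11 := hE c 1 1
  have f00 := hE 0 0 j
  have f01 := hE 1 0 j
  have f10 := hE 0 1 j
  have f11 := hE 1 1 j
  rw [hs] at e10
  simp only [curvatureCoeff, Fin.sum_univ_two] at e00 e01 e10 e11 f00 f01 f10 f11 h0 h1 ⊢
  simp only [hS, hS'] at e00 e01 e10 e11 f00 f01 f10 f11 h0 h1 ⊢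
  linear_combination h0 - h1 + christoffel g e 0 1 j y * e00 + christoffel g e 1 1 j y * e01
    - christoffel g e 0 0 j y * e10 - christoffel g e 1 0 j y * e11
    - (christoffel g e' c 0 0 (e' (e.symm y)) * jacobian e e' 0 1 y +
      christoffel g e' c 0 1 (e' (e.symm y)) * jacobian e e' 1 1 y) * f00
    - (christoffel g e' c 0 1 (e' (e.symm y)) * jacobian e e' 0 1 y +
      christoffel g e' c 1 1 (e' (e.symm y)) * jacobian e e' 1 1 y) * f01
    + (christoffel g e' c 0 0 (e' (e.symm y)) * jacobian e e' 0 0 y +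
      christoffel g e' c 0 1 (e' (e.symm y)) * jacobian e e' 1 0 y) * f10
    + (christoffel g e' c 0 1 (e' (e.symm y)) * jacobian e e' 0 0 y +
      christoffel g e' c 1 1 (e' (e.symm y)) * jacobian e e' 1 0 y) * f11
    + christoffel g e 0 0 j y * hs c

theorem ricciCoeff_zero (l : Fin 2) : ricciCoeff g e 0 l y = - curvatureCoeff g e 0 1 1 l y := by
  simp only [ricciCoeff, curvatureCoeff, Fin.sum_univ_two]; ring

theorem ricciCoeff_one (l : Fin 2) : ricciCoeff g e 1 l y = curvatureCoeff g e 0 1 0 l y := by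
  simp only [ricciCoeff, curvatureCoeff, Fin.sum_univ_two]; ring

/-- In dimension two `Ric = K g` is equivalent to `R₀₁⁰ₗ = K g₁ₗ` and `R₀₁¹ₗ = -K g₀ₗ`. In this form
it is carried over by the curvature law after cancelling `det J` and then the Jacobian of the
remaining index. -/
theorem ricciCoeff_eq_mul_metricCoeff_transition (he : e ∈ IsManifold.maximalAtlas (𝓡 2) ∞ M)
    (he' : e' ∈ IsManifold.maximalAtlas (𝓡 2) ∞ M) (hy : y ∈ e.target)
    (hy' : e.symm y ∈ e'.source) {K : ℝ}
    (h : ∀ i j, ricciCoeff g e i j y = K * metricCoeff g e y i j) (i j : Fin 2) :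
    ricciCoeff g e' i j (e' (e.symm y)) = K * metricCoeff g e' (e' (e.symm y)) i j := by
  have hd := det_jacobian_ne_zero g he he' hy hy'
  have h1 := h 1
  have h0 := h 0
  simp only [ricciCoeff_zero, ricciCoeff_one] at h0 h1
  have hR : ∀ c l, ∑ b : Fin 2, curvatureCoeff g e' 0 1 c b (e' (e.symm y)) * jacobian e e' b l y =
      ∑ b : Fin 2, (K * ![metricCoeff g e' (e' (e.symm y)) 1 b,
        - metricCoeff g e' (e' (e.symm y)) 0 b] c) * jacobian e e' b l y := by
    intro c l
    refine mul_left_cancel₀ hd ?_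
    rw [← curvatureCoeff_transition g he he' hy hy' c l]
    have a0 := h0 l
    have a1 := h1 l
    simp only [metricCoeff_eq_jacobian g he he' hy hy', Fin.sum_univ_two] at a0 a1 ⊢
    rw [metricCoeff_symm g 1 0] at *
    fin_cases c <;> simp <;>
    linear_combination jacobian e e' _ 0 y * a1 - jacobian e e' _ 1 y * a0
  have hR' : ∀ c b, curvatureCoeff g e' 0 1 c b (e' (e.symm y)) =
      K * ![metricCoeff g e' (e' (e.symm y)) 1 b, - metricCoeff g e' (e' (e.symm y)) 0 b] c := by
    intro c b
    have b0 := hR c 0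
    have b1 := hR c 1
    rw [Fin.sum_univ_two, Fin.sum_univ_two] at b0 b1
    have := eq_of_lin_comb_eq (p := jacobian e e' 0 0 y) (q := jacobian e e' 1 0 y)
      (r := jacobian e e' 0 1 y) (s := jacobian e e' 1 1 y)
      (a := curvatureCoeff g e' 0 1 c 0 (e' (e.symm y)))
      (b := curvatureCoeff g e' 0 1 c 1 (e' (e.symm y)))
      (a' := K * ![metricCoeff g e' (e' (e.symm y)) 1 0, - metricCoeff g e' (e' (e.symm y)) 0 0] c)
      (b' := K * ![metricCoeff g e' (e' (e.symm y)) 1 1, - metricCoeff g e' (e' (e.symm y)) 0 1] c)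
      (by convert hd using 1; ring)
      (by linear_combination b0) (by linear_combination b1)
    fin_cases b
    · exact this.1
    · exact this.2
  fin_cases i
  · simp only [Fin.zero_eta, ricciCoeff_zero, hR']
    simp
  · simp only [Fin.mk_one, ricciCoeff_one, hR']
    simp

theorem hasGaussianCurvatureAt_of_chart (he : e ∈ IsManifold.maximalAtlas (𝓡 2) ∞ M) {x : M}
    (hx : x ∈ e.source) {K : ℝ}
    (h : ∀ i j, ricciCoeff g e i j (e x) = K * metricCoeff g e (e x) i j) :
    HasGaussianCurvatureAt g K x := by
  intro e' he' hx' i j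
  have := ricciCoeff_eq_mul_metricCoeff_transition g he he' (e.map_source hx)
    (by rwa [e.left_inv hx]) h i j
  rwa [e.left_inv hx] at this

end CurvatureTransition

/-! ### The acceleration of a curve under a change of chart. -/

section Acceleration

variable (g : Metric M) {e e' : OpenPartialHomeomorph M Plane} {γ : ℝ → M} {t : ℝ}

/-- Equality on a neighbourhood of `t`, not only at `t`, is needed because the acceleration
differentiates this identity. -/
theorem eventually_velocityCoeff_transition (he : e ∈ IsManifold.maximalAtlas (𝓡 2) ∞ M)
    (he' : e' ∈ IsManifold.maximalAtlas (𝓡 2) ∞ M) (hγ : ContinuousAt γ t)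
    (h : γ t ∈ e.source) (h' : γ t ∈ e'.source) (hs : ContDiffAt ℝ ∞ (fun τ => e (γ τ)) t)
    (c : Fin 2) :
    velocityCoeff e' γ c =ᶠ[𝓝 t] fun τ =>
      ∑ k : Fin 2, jacobian e e' c k (e (γ τ)) * velocityCoeff e γ k τ := by
  have hm : ∀ᶠ τ in 𝓝 t, γ τ ∈ e.source ∧ γ τ ∈ e'.source :=
    (hγ.eventually (e.open_source.mem_nhds h)).and (hγ.eventually (e'.open_source.mem_nhds h'))
  have hs1 : ∀ᶠ τ in 𝓝 t, DifferentiableAt ℝ (fun τ => e (γ τ)) τ :=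
    ((hs.of_le (m := 1) (WithTop.coe_le_coe.2 le_top)).eventually (by simp)).mono
      fun _ hx => hx.differentiableAt (by simp)
  filter_upwards [hm.eventually_nhds, hs1] with τ hτ hd
  obtain ⟨hτ1, hτ2⟩ := hτ.self_of_nhds
  have hev : (fun σ => e' (γ σ) c) =ᶠ[𝓝 τ] fun σ => e' (e.symm (e (γ σ))) c :=
    hτ.mono fun σ hσ => by simp only [e.left_inv hσ.1]
  have hF : ContDiffAt ℝ ∞ (fun z => e' (e.symm z) c) (e (γ τ)) :=
    contDiffAt_coord (contDiffAt_transition he he' (e.map_source hτ1)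
      (by rwa [e.left_inv hτ1])) c
  rw [velocityCoeff, hev.deriv_eq]
  exact deriv_comp_curve (F := fun z => e' (e.symm z) c) hF.diff hd

theorem contDiffAt_velocityCoeff (hs : ContDiffAt ℝ ∞ (fun τ => e (γ τ)) t) (k : Fin 2) :
    ContDiffAt ℝ ∞ (velocityCoeff e γ k) t := by
  have h1 : ContDiffAt ℝ ∞ (fun τ => e (γ τ) k) t := contDiffAt_coord hs k
  have h2 : ContDiffAt ℝ ∞ (fderiv ℝ fun τ => e (γ τ) k) t := h1.fderiv_right (by simp)
  exact h2.clm_apply contDiffAt_const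

/-- The second derivatives of the transition map produced by the chain rule are those in the
inhomogeneous term of `christoffel_transition`, so the acceleration transforms as a vector. -/
theorem accelerationCoeff_transition (he : e ∈ IsManifold.maximalAtlas (𝓡 2) ∞ M)
    (he' : e' ∈ IsManifold.maximalAtlas (𝓡 2) ∞ M) (hγ : ContinuousAt γ t)
    (h : γ t ∈ e.source) (h' : γ t ∈ e'.source) (hs : ContDiffAt ℝ ∞ (fun τ => e (γ τ)) t)
    (c : Fin 2) :
    accelerationCoeff g e' γ c t =
      ∑ k : Fin 2, jacobian e e' c k (e (γ t)) * accelerationCoeff g e γ k t := by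
  have hv := fun c => eventually_velocityCoeff_transition he he' hγ h h' hs c
  have hy : e (γ t) ∈ e.target := e.map_source h
  have hy' : e.symm (e (γ t)) ∈ e'.source := by rwa [e.left_inv h]
  have hJ := contDiffAt_jacobian he he' hy hy'
  have hJc : ∀ k, DifferentiableAt ℝ (fun τ => jacobian e e' c k (e (γ τ))) t :=
    fun k => (hJ c k).diff.comp t hs.diff
  have hV := fun k => (contDiffAt_velocityCoeff hs k).diff
  have hd : deriv (velocityCoeff e' γ c) t = ∑ k : Fin 2,
      ((∑ a : Fin 2, partialDeriv a (jacobian e e' c k) (e (γ t)) * velocityCoeff e γ a t) *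
        velocityCoeff e γ k t +
        jacobian e e' c k (e (γ t)) * deriv (velocityCoeff e γ k) t) := by
    rw [(hv c).deriv_eq, deriv_fun_sum fun k _ => (hJc k).fun_mul (hV k)]
    refine Finset.sum_congr rfl fun k _ => ?_
    rw [deriv_fun_mul (hJc k) (hV k), deriv_comp_curve (hJ c k).diff hs.diff]
    rfl
  have hE := fun i j => christoffel_transition g he he' hy hy' c i j
  simp only [accelerationCoeff, hd, (hv _).eq_of_nhds]
  simp only [e.left_inv h, Fin.sum_univ_two] at hE ⊢
  linear_combination - velocityCoeff e γ 0 t * velocityCoeff e γ 0 t * hE 0 0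
    - velocityCoeff e γ 0 t * velocityCoeff e γ 1 t * hE 0 1
    - velocityCoeff e γ 1 t * velocityCoeff e γ 0 t * hE 1 0
    - velocityCoeff e γ 1 t * velocityCoeff e γ 1 t * hE 1 1

end Acceleration

/-! ### Existence of geodesics with given initial position and velocity. -/

section GeodesicExistence

variable (g : Metric M) {e : OpenPartialHomeomorph M Plane} {y v : Plane}

/-- The geodesic spray of the metric `g` in the chart `e`. -/
def spray (g : Metric M) (e : OpenPartialHomeomorph M Plane) (p : Plane × Plane) : Plane × Plane :=
  (p.2, WithLp.toLp 2 fun k =>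
    - ∑ i : Fin 2, ∑ j : Fin 2, christoffel g e k i j p.1 * p.2 i * p.2 j)

theorem contDiffAt_spray (he : e ∈ IsManifold.maximalAtlas (𝓡 2) ∞ M) {p : Plane × Plane}
    (hp : p.1 ∈ e.target) : ContDiffAt ℝ ∞ (spray g e) p := by
  have hv : ∀ i, ContDiffAt ℝ ∞ (fun p : Plane × Plane => p.2 i) p :=
    fun i => contDiffAt_coord contDiffAt_snd i
  refine contDiffAt_snd.prodMk ?_
  rw [contDiffAt_euclidean]
  exact fun k => (ContDiffAt.sum fun i _ => ContDiffAt.sum fun j _ =>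
    (((contDiffAt_christoffel g he hp k i j).comp p contDiffAt_fst).mul (hv i)).mul (hv j)).neg

theorem exists_spray_curve (he : e ∈ IsManifold.maximalAtlas (𝓡 2) ∞ M) (hy : y ∈ e.target)
    (hv : v ≠ 0) : ∃ α : ℝ → Plane × Plane, α 0 = (y, v) ∧ ∃ ε > 0,
      ContDiffOn ℝ ∞ α (Set.Ioo (-ε) ε) ∧ ∀ t ∈ Set.Ioo (-ε) ε, (α t).1 ∈ e.target ∧
        (α t).2 ≠ 0 ∧ HasDerivAt α (spray g e (α t)) t := by
  obtain ⟨α, h0, ε, hε, hα⟩ :=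
    ((contDiffAt_spray g he (p := (y, v)) hy).of_le (m := 1)
      (WithTop.coe_le_coe.2 le_top)).exists_forall_mem_closedBall_exists_eq_forall_mem_Ioo_hasDerivAt₀ 0
  simp only [zero_sub, zero_add] at hα
  have hc : ContinuousAt α 0 := (hα 0 ⟨by linarith, hε⟩).continuousAt
  have hU : IsOpen (e.target ×ˢ {w : Plane | w ≠ 0}) := e.open_target.prod isOpen_ne
  have hmem : ∀ᶠ t in 𝓝 0, α t ∈ e.target ×ˢ {w : Plane | w ≠ 0} :=
    hc.eventually (hU.mem_nhds (by rw [h0]; exact ⟨hy, hv⟩))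
  obtain ⟨δ, hδ, hball⟩ := Metric.eventually_nhds_iff.1 hmem
  have hr : ∀ t, t ∈ Set.Icc (-(min ε δ / 2)) (min ε δ / 2) →
      t ∈ Set.Ioo (-ε) ε ∧ α t ∈ e.target ×ˢ {w : Plane | w ≠ 0} := by
    intro t ht
    have hpos : 0 < min ε δ := lt_min hε hδ
    have h1 := min_le_left ε δ
    have h2 := min_le_right ε δ
    refine ⟨⟨by linarith [ht.1], by linarith [ht.2]⟩, hball ?_⟩
    rw [Real.dist_eq, sub_zero, abs_lt]
    exact ⟨by linarith [ht.1], by linarith [ht.2]⟩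
  -- Halving the radius puts a closed interval inside the open ones, where smoothness of the field
  -- bootstraps to smoothness of the solution.
  have hsm : ContDiffOn ℝ ∞ α (Set.Icc (-(min ε δ / 2)) (min ε δ / 2)) := by
    refine ODE.contDiffOn_enat_Icc_of_hasDerivWithinAt (n := ⊤) (f := fun _ => spray g e)
      (u := e.target ×ˢ {w : Plane | w ≠ 0}) ?_ (fun t ht => (hα t (hr t ht).1).hasDerivWithinAt)
      (fun t ht => (hr t ht).2)
    intro p hp
    exact ((contDiffAt_spray g he hp.2.1).comp p contDiffAt_snd).contDiffWithinAt
  refine ⟨α, h0, min ε δ / 2, half_pos (lt_min hε hδ), hsm.mono Set.Ioo_subset_Icc_self,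
    fun t ht => ?_⟩
  have := hr t (Set.Ioo_subset_Icc_self ht)
  exact ⟨this.2.1, this.2.2, hα t this.1⟩

theorem exists_geodesic (he : e ∈ IsManifold.maximalAtlas (𝓡 2) ∞ M) (hy : y ∈ e.target)
    (hv : v ≠ 0) : ∃ (γ : ℝ → M) (ε : ℝ), 0 < ε ∧ IsUnparamGeodesicOn g γ (Set.Ioo (-ε) ε) ∧
      Set.MapsTo γ (Set.Ioo (-ε) ε) e.source ∧ e (γ 0) = y ∧
      ContDiffAt ℝ ∞ (fun t => e (γ t)) 0 ∧ (∀ k, velocityCoeff e γ k 0 = v k) ∧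
      ∀ k, accelerationCoeff g e γ k 0 = 0 := by
  obtain ⟨α, h0, ε, hε, hs, hα⟩ := exists_spray_curve g he hy hv
  have hso : IsOpen (Set.Ioo (-ε) ε) := isOpen_Ioo
  have heγ : ∀ t ∈ Set.Ioo (-ε) ε, e (e.symm (α t).1) = (α t).1 :=
    fun t ht => e.right_inv (hα t ht).1
  have hev : ∀ t ∈ Set.Ioo (-ε) ε, (fun t => e (e.symm (α t).1)) =ᶠ[𝓝 t] fun t => (α t).1 :=
    fun t ht => eventually_of_mem (hso.mem_nhds ht) heγ
  have hc : ∀ t ∈ Set.Ioo (-ε) ε, ContDiffAt ℝ ∞ (fun t => (α t).1) t :=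
    fun t ht => contDiffAt_fst.comp t (hs.contDiffAt (hso.mem_nhds ht))
  have hce : ∀ t ∈ Set.Ioo (-ε) ε, ContDiffAt ℝ ∞ (fun t => e (e.symm (α t).1)) t :=
    fun t ht => (hc t ht).congr_of_eventuallyEq (hev t ht)
  have hvel : ∀ k, ∀ t ∈ Set.Ioo (-ε) ε,
      velocityCoeff e (fun t => e.symm (α t).1) k t = (α t).2 k := by
    intro k t ht
    have h1 : HasDerivAt (fun t => (α t).1) (α t).2 t := (hα t ht).2.2.fst
    have h2 : HasDerivAt (fun t => (α t).1 k) ((α t).2 k) t :=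
      (EuclideanSpace.proj (𝕜 := ℝ) k : Plane →L[ℝ] ℝ).hasFDerivAt.comp_hasDerivAt t h1
    rw [velocityCoeff]
    have h3 : (fun t => e (e.symm (α t).1) k) =ᶠ[𝓝 t] fun t => (α t).1 k :=
      (hev t ht).mono fun _ h => congrArg (fun p : Plane => p k) h
    rw [h3.deriv_eq, h2.deriv]
  have hacc : ∀ k, ∀ t ∈ Set.Ioo (-ε) ε,
      accelerationCoeff g e (fun t => e.symm (α t).1) k t = 0 := by
    intro k t ht
    have h1 : HasDerivAt (fun t => (α t).2) (spray g e (α t)).2 t := (hα t ht).2.2.snd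
    have h2 : HasDerivAt (fun t => (α t).2 k) ((spray g e (α t)).2 k) t :=
      (EuclideanSpace.proj (𝕜 := ℝ) k : Plane →L[ℝ] ℝ).hasFDerivAt.comp_hasDerivAt t h1
    have h3 : velocityCoeff e (fun t => e.symm (α t).1) k =ᶠ[𝓝 t] fun t => (α t).2 k :=
      eventually_of_mem (hso.mem_nhds ht) (hvel k)
    rw [accelerationCoeff, h3.deriv_eq, h2.deriv, heγ t ht]
    simp only [hvel _ t ht, spray]
    ring
  have hsm : ContMDiffOn 𝓘(ℝ, ℝ) (𝓡 2) ∞ (fun t => e.symm (α t).1) (Set.Ioo (-ε) ε) :=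
    fun t ht => ((contMDiffAt_symm_of_mem_maximalAtlas he (hα t ht).1).comp t
      (contMDiffAt_iff_contDiffAt.2 (hc t ht))).contMDiffWithinAt
  have hz : (0 : ℝ) ∈ Set.Ioo (-ε) ε := ⟨by linarith, hε⟩
  -- Solutions of the spray are affinely parameterised, so the factor `f` is zero.
  refine ⟨fun t => e.symm (α t).1, ε, hε, ⟨hsm, fun t ht h => ?_, fun _ => 0, contDiffOn_const,
    fun t ht e' he' ht' k => ?_⟩, fun t ht => e.map_target (hα t ht).1, ?_, hce 0 hz, ?_,
    fun k => hacc k 0 hz⟩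
  · have h2 : MDifferentiableAt (𝓡 2) (𝓡 2) e (e.symm (α t).1) :=
      (contMDiffAt_of_mem_maximalAtlas he (e.map_target (hα t ht).1)).mdifferentiableAt (by simp)
    have h3 : MDifferentiableAt 𝓘(ℝ, ℝ) (𝓡 2) (fun t => e.symm (α t).1) t :=
      (hsm.contMDiffAt (hso.mem_nhds ht)).mdifferentiableAt (by simp)
    have h4 := mfderiv_comp t h2 h3
    rw [h, ContinuousLinearMap.comp_zero, mfderiv_eq_fderiv] at h4
    have h5 : fderiv ℝ (fun t => e (e.symm (α t).1)) t = 0 := h4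
    rw [(hev t ht).fderiv_eq] at h5
    have h1 : HasDerivAt (fun t => (α t).1) (α t).2 t := (hα t ht).2.2.fst
    refine (hα t ht).2.1 ?_
    rw [← h1.deriv, ← fderiv_apply_one_eq_deriv, h5]
    rfl
  · rw [accelerationCoeff_transition g he he' (hsm.continuousOn.continuousAt (hso.mem_nhds ht))
      (e.map_target (hα t ht).1) ht' (hce t ht)]
    simp [hacc _ t ht]
  · simp only [h0, e.right_inv hy]
  · intro k
    rw [hvel k 0 hz, h0]

end GeodesicExistence

/-! ### Straight geodesics force locally constant curvature. -/

section Straight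

variable (g : Metric M) {e : OpenPartialHomeomorph M Plane} {y : Plane}

theorem exists_linear_eq_of_collinear {S : Set Plane} (h : Collinear ℝ S) :
    ∃ a b d : ℝ, (a ≠ 0 ∨ b ≠ 0) ∧ ∀ p ∈ S, a * p 0 + b * p 1 = d := by
  obtain ⟨p₀, w, hw⟩ := (collinear_iff_exists_forall_eq_smul_vadd S).1 h
  by_cases h0 : w = 0
  · refine ⟨1, 0, p₀ 0, by simp, fun p hp => ?_⟩
    obtain ⟨r, rfl⟩ := hw p hp
    simp [h0]
  · refine ⟨w 1, - w 0, w 1 * p₀ 0 - w 0 * p₀ 1, ?_, fun p hp => ?_⟩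
    · by_contra! hn
      exact h0 (by ext i; fin_cases i; exacts [neg_eq_zero.1 hn.2, hn.1])
    · obtain ⟨r, rfl⟩ := hw p hp
      simp
      ring

/-- Differentiating the equation `a x⁰ + b x¹ = d` of the line once and twice along the geodesic
shows that `(a, b) ≠ 0` annihilates both `v` and `Γ(v, v)`. In the plane these two vectors are
therefore parallel. -/
theorem christoffel_quadratic_of_straight (he : e ∈ IsManifold.maximalAtlas (𝓡 2) ∞ M)
    (hs : GeodesicsBecomeStraight g e) (hy : y ∈ e.target) (v : Plane) :
    (∑ i : Fin 2, ∑ j : Fin 2, christoffel g e 0 i j y * v i * v j) * v 1 =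
      (∑ i : Fin 2, ∑ j : Fin 2, christoffel g e 1 i j y * v i * v j) * v 0 := by
  by_cases hv : v = 0
  · simp [hv]
  obtain ⟨γ, ε, hε, hγ, hmaps, hy0, hcd, hvel, hacc⟩ := exists_geodesic g he hy hv
  have hcol := hs γ _ isOpen_Ioo isPreconnected_Ioo hγ hmaps
  obtain ⟨a, b, d, hab, hlin⟩ := exists_linear_eq_of_collinear hcol
  have hz : (0 : ℝ) ∈ Set.Ioo (-ε) ε := ⟨by linarith, hε⟩
  have hev : (fun t => a * e (γ t) 0 + b * e (γ t) 1) =ᶠ[𝓝 0] fun _ => d :=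
    eventually_of_mem (isOpen_Ioo.mem_nhds hz) fun t ht => hlin _ ⟨t, ht, rfl⟩
  have hcd1 : ∀ᶠ t in 𝓝 (0 : ℝ), DifferentiableAt ℝ (fun τ => e (γ τ)) t :=
    ((hcd.of_le (m := 1) (WithTop.coe_le_coe.2 le_top)).eventually (by simp)).mono
      fun _ hx => hx.differentiableAt (by simp)
  have hk : ∀ k t, DifferentiableAt ℝ (fun τ => e (γ τ)) t →
      DifferentiableAt ℝ (fun τ => e (γ τ) k) t := fun k t h =>
    (EuclideanSpace.proj (𝕜 := ℝ) k : Plane →L[ℝ] ℝ).differentiableAt.comp t h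
  have hev1 : (fun t => a * velocityCoeff e γ 0 t + b * velocityCoeff e γ 1 t) =ᶠ[𝓝 0]
      fun _ => 0 := by
    filter_upwards [hev.eventuallyEq_nhds, hcd1] with t ht hd
    have := ht.deriv_eq
    rw [deriv_fun_add ((hk 0 t hd).const_mul a) ((hk 1 t hd).const_mul b), deriv_const_mul _ (hk 0 t hd),
      deriv_const_mul _ (hk 1 t hd), deriv_const] at this
    exact this
  have hV := fun k => (contDiffAt_velocityCoeff hcd k).diff
  have h1 := hev1.eq_of_nhds
  have h2 := hev1.deriv_eq
  rw [deriv_fun_add ((hV 0).const_mul a) ((hV 1).const_mul b), deriv_const_mul _ (hV 0),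
      deriv_const_mul _ (hV 1), deriv_const] at h2
  simp only [accelerationCoeff, hvel, hy0] at hacc h1
  rw [eq_neg_of_add_eq_zero_left (hacc 0), eq_neg_of_add_eq_zero_left (hacc 1)] at h2
  generalize (∑ i : Fin 2, ∑ j : Fin 2, christoffel g e 0 i j y * v i * v j) = X at *
  generalize (∑ i : Fin 2, ∑ j : Fin 2, christoffel g e 1 i j y * v i * v j) = Y at *
  rcases hab with h | h
  · exact mul_left_cancel₀ h (by linear_combination -v 1 * h2 - Y * h1)
  · exact mul_left_cancel₀ h (by linear_combination v 0 * h2 + X * h1)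

/-- The Christoffel symbols have the form `Γᵏᵢⱼ = δᵏᵢ φⱼ + δᵏⱼ φᵢ`, with `φ₀ = Γ¹₀₁` and
`φ₁ = Γ⁰₀₁`. -/
structure ProjectivelyFlatAt (g : Metric M) (e : OpenPartialHomeomorph M Plane) (y : Plane) :
    Prop where
  one_zero_zero : christoffel g e 1 0 0 y = 0
  zero_one_one : christoffel g e 0 1 1 y = 0
  zero_zero_zero : christoffel g e 0 0 0 y = 2 * christoffel g e 1 0 1 y
  one_one_one : christoffel g e 1 1 1 y = 2 * christoffel g e 0 0 1 y

theorem projectivelyFlatAt_of_straight (he : e ∈ IsManifold.maximalAtlas (𝓡 2) ∞ M)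
    (hs : GeodesicsBecomeStraight g e) (hy : y ∈ e.target) : ProjectivelyFlatAt g e y := by
  have h := fun a b : ℝ => christoffel_quadratic_of_straight g he hs hy (!₂[a, b])
  simp only [Fin.sum_univ_two, christoffel_symm g _ 1 0] at h
  -- The identity is a binary cubic in `v`; four pairwise independent test vectors isolate its four
  -- coefficients.
  have h1 := h 1 0
  have h2 := h 0 1
  have h3 := h 1 1
  have h4 := h 1 (-1)
  simp at h1 h2 h3 h4
  constructor <;> linarith

/-- With `φ₀ = Γ¹₀₁` and `φ₁ = Γ⁰₀₁`, these are the conditions `∂₁∂₀ gᵢⱼ = ∂₀∂₁ gᵢⱼ` for the system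
`∂ᵢ gⱼₗ = 2 φᵢ gⱼₗ + φⱼ gᵢₗ + φₗ gᵢⱼ`. They say that `φ` is closed and that the symmetric form `φᵢ
φⱼ - ∂ᵢ φⱼ` is proportional to `g`. -/
theorem projective_integrability (he : e ∈ IsManifold.maximalAtlas (𝓡 2) ∞ M)
    (hf : ∀ z ∈ e.target, ProjectivelyFlatAt g e z) (hy : y ∈ e.target) :
    partialDeriv 1 (christoffel g e 1 0 1) y = partialDeriv 0 (christoffel g e 0 0 1) y ∧
    (christoffel g e 1 0 1 y ^ 2 - partialDeriv 0 (christoffel g e 1 0 1) y) *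
      metricCoeff g e y 0 1 = metricCoeff g e y 0 0 *
      (christoffel g e 1 0 1 y * christoffel g e 0 0 1 y -
        partialDeriv 1 (christoffel g e 1 0 1) y) ∧
    (christoffel g e 1 0 1 y ^ 2 - partialDeriv 0 (christoffel g e 1 0 1) y) *
      metricCoeff g e y 1 1 = metricCoeff g e y 0 0 *
      (christoffel g e 0 0 1 y ^ 2 - partialDeriv 1 (christoffel g e 0 0 1) y) := by
  have ha := contDiffAt_christoffel g he hy 1 0 1
  have hb := contDiffAt_christoffel g he hy 0 0 1
  have hG := contDiffAt_metricCoeff g he hy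
  have hd := det_metricCoeff_pos g he hy
  have hg0 := metricCoeff_zero_zero_pos g he hy
  have hM : ∀ i j l, ∀ z ∈ e.target, partialDeriv i (fun z => metricCoeff g e z j l) z = _ :=
    fun i j l z hz => partialDeriv_metricCoeff g he hz i j l
  have hMe : ∀ i j l, partialDeriv i (fun z => metricCoeff g e z j l) =ᶠ[𝓝 y] fun z =>
      ∑ m : Fin 2, (christoffel g e m i j z * metricCoeff g e z m l +
        christoffel g e m i l z * metricCoeff g e z m j) :=
    fun i j l => eventually_of_mem (e.open_target.mem_nhds hy) (hM i j l)
  have hfe : ∀ᶠ z in 𝓝 y, ProjectivelyFlatAt g e z := eventually_of_mem (e.open_target.mem_nhds hy) hf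
  have e000 : partialDeriv 0 (fun z => metricCoeff g e z 0 0) =ᶠ[𝓝 y] fun z =>
      4 * (christoffel g e 1 0 1 z * metricCoeff g e z 0 0) := by
    filter_upwards [hMe 0 0 0, hfe] with z hz hp
    rw [hz, Fin.sum_univ_two, hp.zero_zero_zero, hp.one_zero_zero]; ring
  have e001 : partialDeriv 0 (fun z => metricCoeff g e z 0 1) =ᶠ[𝓝 y] fun z =>
      3 * (christoffel g e 1 0 1 z * metricCoeff g e z 0 1) +
        christoffel g e 0 0 1 z * metricCoeff g e z 0 0 := by
    filter_upwards [hMe 0 0 1, hfe] with z hz hp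
    rw [hz, Fin.sum_univ_two, hp.zero_zero_zero, hp.one_zero_zero, metricCoeff_symm g 1 0]; ring
  have e011 : partialDeriv 0 (fun z => metricCoeff g e z 1 1) =ᶠ[𝓝 y] fun z =>
      2 * (christoffel g e 0 0 1 z * metricCoeff g e z 0 1) +
        2 * (christoffel g e 1 0 1 z * metricCoeff g e z 1 1) := by
    filter_upwards [hMe 0 1 1, hfe] with z hz hp
    rw [hz, Fin.sum_univ_two]; ring
  have e100 : partialDeriv 1 (fun z => metricCoeff g e z 0 0) =ᶠ[𝓝 y] fun z =>
      2 * (christoffel g e 0 0 1 z * metricCoeff g e z 0 0) +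
        2 * (christoffel g e 1 0 1 z * metricCoeff g e z 0 1) := by
    filter_upwards [hMe 1 0 0, hfe] with z hz hp
    rw [hz, Fin.sum_univ_two, christoffel_symm g 0 1 0, christoffel_symm g 1 1 0,
      metricCoeff_symm g 1 0]; ring
  have e101 : partialDeriv 1 (fun z => metricCoeff g e z 0 1) =ᶠ[𝓝 y] fun z =>
      3 * (christoffel g e 0 0 1 z * metricCoeff g e z 0 1) +
        christoffel g e 1 0 1 z * metricCoeff g e z 1 1 := by
    filter_upwards [hMe 1 0 1, hfe] with z hz hp
    rw [hz, Fin.sum_univ_two, christoffel_symm g 0 1 0, christoffel_symm g 1 1 0,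
      hp.one_one_one, hp.zero_one_one, metricCoeff_symm g 1 0]; ring
  have e111 : partialDeriv 1 (fun z => metricCoeff g e z 1 1) =ᶠ[𝓝 y] fun z =>
      4 * (christoffel g e 0 0 1 z * metricCoeff g e z 1 1) := by
    filter_upwards [hMe 1 1 1, hfe] with z hz hp
    rw [hz, Fin.sum_univ_two, hp.one_one_one, hp.zero_one_one]; ring
  have D : ∀ (c : ℝ) (i : Fin 2) {H G : Plane → ℝ}, ContDiffAt ℝ ∞ H y → ContDiffAt ℝ ∞ G y →
      partialDeriv i (fun z => c * (H z * G z)) y =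
        c * (partialDeriv i H y * G y + H y * partialDeriv i G y) := by
    intro c i H G hH hG
    rw [partialDeriv_const_mul c (hH.mul hG).diff, partialDeriv_mul hH.diff hG.diff]
  have s00 := partialDeriv_comm (hG 0 0) 1 0
  have s01 := partialDeriv_comm (hG 0 1) 1 0
  have s11 := partialDeriv_comm (hG 1 1) 1 0
  rw [partialDeriv_congr e000, partialDeriv_congr e100, D 4 1 ha (hG 0 0),
    partialDeriv_add (contDiffAt_const.mul (hb.mul (hG 0 0))).diff
      (contDiffAt_const.mul (ha.mul (hG 0 1))).diff, D 2 0 hb (hG 0 0), D 2 0 ha (hG 0 1),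
      e000.eq_of_nhds, e001.eq_of_nhds, e100.eq_of_nhds] at s00
  rw [partialDeriv_congr e001, partialDeriv_congr e101,
    partialDeriv_add (contDiffAt_const.mul (ha.mul (hG 0 1))).diff (hb.mul (hG 0 0)).diff,
    partialDeriv_add (contDiffAt_const.mul (hb.mul (hG 0 1))).diff (ha.mul (hG 1 1)).diff,
    D 3 1 ha (hG 0 1), D 3 0 hb (hG 0 1), partialDeriv_mul hb.diff (hG 0 0).diff,
    partialDeriv_mul ha.diff (hG 1 1).diff,
    e001.eq_of_nhds, e101.eq_of_nhds, e100.eq_of_nhds, e011.eq_of_nhds] at s01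
  rw [partialDeriv_congr e011, partialDeriv_congr e111, D 4 0 hb (hG 1 1),
    partialDeriv_add (contDiffAt_const.mul (hb.mul (hG 0 1))).diff
      (contDiffAt_const.mul (ha.mul (hG 1 1))).diff, D 2 1 hb (hG 0 1), D 2 1 ha (hG 1 1),
      e011.eq_of_nhds, e101.eq_of_nhds, e111.eq_of_nhds] at s11
  generalize metricCoeff g e y 0 0 = g00 at *
  generalize metricCoeff g e y 0 1 = g01 at *
  generalize metricCoeff g e y 1 1 = g11 at *
  generalize christoffel g e 1 0 1 y = a at *
  generalize christoffel g e 0 0 1 y = b at *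
  generalize partialDeriv 0 (christoffel g e 1 0 1) y = a0 at *
  generalize partialDeriv 1 (christoffel g e 1 0 1) y = a1 at *
  generalize partialDeriv 0 (christoffel g e 0 0 1) y = b0 at *
  generalize partialDeriv 1 (christoffel g e 0 0 1) y = b1 at *
  -- Contracting the three conditions with the adjugate of `g` removes the symmetric part of `∂φ`
  -- and leaves `det g` times the antisymmetric part.
  have hclosed : a1 = b0 := by
    have : (g00 * g11 - g01 ^ 2) * (a1 - b0) = 0 := by
      linear_combination (1/6) * g11 * s00 + (1/6) * g00 * s11 - (1/3) * g01 * s01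
    rcases mul_eq_zero.1 this with h | h
    · exact absurd h hd.ne'
    · linarith
  subst hclosed
  refine ⟨rfl, ?_, ?_⟩
  · linear_combination (1/2) * s00
  · linear_combination s01

/-- The Gaussian curvature in a chart in which the geodesics are straight. -/
def projectiveCurvature (g : Metric M) (e : OpenPartialHomeomorph M Plane) (y : Plane) : ℝ :=
  (christoffel g e 1 0 1 y ^ 2 - partialDeriv 0 (christoffel g e 1 0 1) y) / metricCoeff g e y 0 0

theorem projectiveCurvature_mul (he : e ∈ IsManifold.maximalAtlas (𝓡 2) ∞ M)
    (hf : ∀ z ∈ e.target, ProjectivelyFlatAt g e z) (hy : y ∈ e.target) :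
    christoffel g e 1 0 1 y ^ 2 - partialDeriv 0 (christoffel g e 1 0 1) y =
      projectiveCurvature g e y * metricCoeff g e y 0 0 ∧
    christoffel g e 1 0 1 y * christoffel g e 0 0 1 y - partialDeriv 1 (christoffel g e 1 0 1) y =
      projectiveCurvature g e y * metricCoeff g e y 0 1 ∧
    christoffel g e 1 0 1 y * christoffel g e 0 0 1 y - partialDeriv 0 (christoffel g e 0 0 1) y =
      projectiveCurvature g e y * metricCoeff g e y 0 1 ∧
    christoffel g e 0 0 1 y ^ 2 - partialDeriv 1 (christoffel g e 0 0 1) y =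
      projectiveCurvature g e y * metricCoeff g e y 1 1 := by
  obtain ⟨h1, h2, h3⟩ := projective_integrability g he hf hy
  have h0 := (metricCoeff_zero_zero_pos g he hy).ne'
  rw [← h1]
  simp only [projectiveCurvature]
  refine ⟨?_, ?_, ?_, ?_⟩
  · field_simp
  · field_simp; linarith
  · field_simp; linarith
  · field_simp; linarith

theorem ricciCoeff_of_projectivelyFlat (he : e ∈ IsManifold.maximalAtlas (𝓡 2) ∞ M)
    (hf : ∀ z ∈ e.target, ProjectivelyFlatAt g e z) (hy : y ∈ e.target) (i j : Fin 2) :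
    ricciCoeff g e i j y = projectiveCurvature g e y * metricCoeff g e y i j := by
  obtain ⟨k00, k01, k10, k11⟩ := projectiveCurvature_mul g he hf hy
  have ha := contDiffAt_christoffel g he hy 1 0 1
  have hb := contDiffAt_christoffel g he hy 0 0 1
  have hfe : ∀ᶠ z in 𝓝 y, ProjectivelyFlatAt g e z :=
    eventually_of_mem (e.open_target.mem_nhds hy) hf
  have hp := hf y hy
  have c1 : ∀ d, partialDeriv d (christoffel g e 1 0 0) y = 0 := fun d => by
    rw [partialDeriv_congr (G := fun _ => 0) (hfe.mono fun z hz => hz.one_zero_zero),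
      partialDeriv_const]
  have c2 : ∀ d, partialDeriv d (christoffel g e 0 1 1) y = 0 := fun d => by
    rw [partialDeriv_congr (G := fun _ => 0) (hfe.mono fun z hz => hz.zero_one_one),
      partialDeriv_const]
  have c3 : ∀ d, partialDeriv d (christoffel g e 0 0 0) y =
      2 * partialDeriv d (christoffel g e 1 0 1) y := fun d => by
    rw [partialDeriv_congr (hfe.mono fun z hz => hz.zero_zero_zero),
      partialDeriv_const_mul 2 ha.diff]
  have c4 : ∀ d, partialDeriv d (christoffel g e 1 1 1) y =
      2 * partialDeriv d (christoffel g e 0 0 1) y := fun d => by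
    rw [partialDeriv_congr (hfe.mono fun z hz => hz.one_one_one),
      partialDeriv_const_mul 2 hb.diff]
  have hs : ∀ k, christoffel g e k 1 0 = christoffel g e k 0 1 := fun k => by
    ext z; exact christoffel_symm g k 1 0
  fin_cases i <;> fin_cases j <;>
    simp only [Fin.zero_eta, Fin.mk_one, ricciCoeff_zero, ricciCoeff_one, curvatureCoeff,
      Fin.sum_univ_two, hs, c1, c2, c3, c4, hp.one_zero_zero, hp.zero_one_one, hp.zero_zero_zero,
      hp.one_one_one, metricCoeff_symm g 1 0]
  · linear_combination k00
  · linear_combination 2 * k10 - k01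
  · linear_combination 2 * k01 - k10
  · linear_combination k11

theorem contDiffAt_projectiveCurvature (he : e ∈ IsManifold.maximalAtlas (𝓡 2) ∞ M)
    (hy : y ∈ e.target) : ContDiffAt ℝ ∞ (projectiveCurvature g e) y := by
  have ha := contDiffAt_christoffel g he hy 1 0 1
  exact ((ha.pow 2).sub (contDiffAt_partialDeriv ha 0)).div (contDiffAt_metricCoeff g he hy 0 0)
    (metricCoeff_zero_zero_pos g he hy).ne'

/-- Differentiate `φᵢ φⱼ - ∂ᵢ φⱼ = K gᵢⱼ` and antisymmetrise: the second derivatives of `φ` cancel,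
and the equation itself absorbs the first order terms. What remains is `g₀₀ ∂₁K = g₀₁ ∂₀K` and `g₁₁
∂₀K = g₀₁ ∂₁K`, so `dK = 0` because `det g ≠ 0`. -/
theorem fderiv_projectiveCurvature (he : e ∈ IsManifold.maximalAtlas (𝓡 2) ∞ M)
    (hf : ∀ z ∈ e.target, ProjectivelyFlatAt g e z) (hy : y ∈ e.target) :
    fderiv ℝ (projectiveCurvature g e) y = 0 := by
  have hk := fun z hz => projectiveCurvature_mul g he hf (y := z) hz
  have ha := contDiffAt_christoffel g he hy 1 0 1
  have hb := contDiffAt_christoffel g he hy 0 0 1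
  have hG := contDiffAt_metricCoeff g he hy
  have hK := contDiffAt_projectiveCurvature g he hy
  have hp := hf y hy
  have hT := e.open_target.mem_nhds hy
  have D : ∀ i {H L N : Plane → ℝ} {a b}, ContDiffAt ℝ ∞ H y → ContDiffAt ℝ ∞ L y →
      ContDiffAt ℝ ∞ N y → (∀ z ∈ e.target, H z * L z - N z =
        projectiveCurvature g e z * metricCoeff g e z a b) →
      partialDeriv i H y * L y + H y * partialDeriv i L y - partialDeriv i N y =
        partialDeriv i (projectiveCurvature g e) y * metricCoeff g e y a b +
        projectiveCurvature g e y * partialDeriv i (fun z => metricCoeff g e z a b) y := by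
    intro i H L N a b hH hL hN h
    rw [← partialDeriv_mul hK.diff (hG a b).diff, ← partialDeriv_mul hH.diff hL.diff,
      ← partialDeriv_sub (hH.mul hL).diff hN.diff]
    exact partialDeriv_congr (eventually_of_mem hT h)
  have hpa := contDiffAt_partialDeriv ha
  have hpb := contDiffAt_partialDeriv hb
  have d00 := D 1 ha ha (hpa 0) fun z hz => by rw [← (hk z hz).1]; ring
  have d01 := D 0 ha hb (hpa 1) fun z hz => (hk z hz).2.1
  have d10 := D 1 ha hb (hpb 0) fun z hz => (hk z hz).2.2.1
  have d11 := D 0 hb hb (hpb 1) fun z hz => by rw [← (hk z hz).2.2.2]; ring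
  rw [partialDeriv_comm ha 1 0] at d00
  rw [partialDeriv_comm hb 1 0] at d10
  obtain ⟨k00, k01, k10, k11⟩ := hk y hy
  simp only [partialDeriv_metricCoeff g he hy, Fin.sum_univ_two, christoffel_symm g _ 1 0,
    hp.one_zero_zero, hp.zero_one_one, hp.zero_zero_zero, hp.one_one_one,
    metricCoeff_symm g 1 0] at d00 d01 d10 d11
  have hd := (det_metricCoeff_pos g he hy).ne'
  have := eq_of_lin_comb_eq (p := metricCoeff g e y 0 0) (q := - metricCoeff g e y 0 1)
    (r := - metricCoeff g e y 0 1) (s := metricCoeff g e y 1 1)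
    (a := partialDeriv 1 (projectiveCurvature g e) y)
    (b := partialDeriv 0 (projectiveCurvature g e) y) (a' := 0) (b' := 0)
    (by convert hd using 1; ring)
    (by linear_combination d01 - d00 + christoffel g e 0 0 1 y * k00 +
          christoffel g e 1 0 1 y * k10 - 2 * christoffel g e 1 0 1 y * k01)
    (by linear_combination d10 - d11 + christoffel g e 0 0 1 y * k01 +
          christoffel g e 1 0 1 y * k11 - 2 * christoffel g e 0 0 1 y * k10)
  ext v
  rw [fderiv_eq_partialDeriv, this.1, this.2]
  simp

theorem eventually_hasGaussianCurvatureAt_of_straight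
    (he : e ∈ IsManifold.maximalAtlas (𝓡 2) ∞ M) (hs : GeodesicsBecomeStraight g e) {x : M}
    (hx : x ∈ e.source) : ∃ K : ℝ, ∀ᶠ x' in 𝓝 x, HasGaussianCurvatureAt g K x' := by
  have hf : ∀ z ∈ e.target, ProjectivelyFlatAt g e z :=
    fun z hz => projectivelyFlatAt_of_straight g he hs hz
  -- The chart target may be disconnected, so the vanishing derivative is integrated only on a ball.
  obtain ⟨r, hr, hball⟩ := Metric.isOpen_iff.1 e.open_target _ (e.map_source hx)
  refine ⟨projectiveCurvature g e (e x), ?_⟩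
  have hB : ∀ᶠ x' in 𝓝 x, x' ∈ e.source ∧ e x' ∈ Metric.ball (e x) r :=
    (eventually_of_mem (e.open_source.mem_nhds hx) fun _ h => h).and
      ((e.continuousAt hx).eventually (Metric.ball_mem_nhds _ hr))
  refine hB.mono fun x' hx' => hasGaussianCurvatureAt_of_chart g he hx'.1 fun i j => ?_
  rw [ricciCoeff_of_projectivelyFlat g he hf (e.map_source hx'.1)]
  congr 1
  refine Metric.isOpen_ball.is_const_of_fderiv_eq_zero (𝕜 := ℝ)
    (convex_ball (e x) r).isPreconnected (fun z hz => ?_) (fun z hz => ?_) hx'.2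
    (Metric.mem_ball_self hr)
  · exact (contDiffAt_projectiveCurvature g he (hball hz)).diff.differentiableWithinAt
  · exact fderiv_projectiveCurvature g he hf (hball hz)

end Straight

/-! ### From locally constant to constant curvature. -/

section Globalization

variable (g : Metric M)

theorem HasGaussianCurvatureAt.unique {K K' : ℝ} {x : M} (h : HasGaussianCurvatureAt g K x)
    (h' : HasGaussianCurvatureAt g K' x) : K = K' := by
  have he := IsManifold.chart_mem_maximalAtlas (I := 𝓡 2) (n := ∞) x
  have hx := mem_chart_source Plane x
  have h1 := h _ he hx 0 0
  rw [h' _ he hx 0 0] at h1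
  exact (mul_right_cancel₀
    (metricCoeff_zero_zero_pos g he ((chartAt Plane x).map_source hx)).ne' h1).symm

theorem hasConstantCurvature_of_straight [PreconnectedSpace M]
    (h : ∀ x : M, ∃ e ∈ IsManifold.maximalAtlas (𝓡 2) ∞ M,
      x ∈ e.source ∧ GeodesicsBecomeStraight g e) : HasConstantCurvature g := by
  have hloc : ∀ x : M, ∃ K : ℝ, ∀ᶠ x' in 𝓝 x, HasGaussianCurvatureAt g K x' := fun x => by
    obtain ⟨e, he, hx, hs⟩ := h x
    exact eventually_hasGaussianCurvatureAt_of_straight g he hs hx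
  choose K hK using hloc
  have hconst : IsLocallyConstant K := by
    rw [IsLocallyConstant.iff_eventually_eq]
    exact fun x => (hK x).mono fun x' hx' =>
      HasGaussianCurvatureAt.unique g (hK x').self_of_nhds hx'
  -- A preconnected space may be empty; any constant serves then.
  rcases isEmpty_or_nonempty M with hM | ⟨⟨x₀⟩⟩
  · exact ⟨0, fun x => hM.elim x⟩
  · refine ⟨K x₀, fun x => ?_⟩
    rw [hconst.apply_eq_of_preconnectedSpace x₀ x]
    exact (hK x).self_of_nhds

end Globalization

/-! ### The Frobenius theorem for flat linear systems `dY = Ω Y`. -/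

section Frobenius

set_option maxSynthPendingDepth 3

variable {E V : Type*} [NormedAddCommGroup E] [NormedSpace ℝ E] [NormedAddCommGroup V]
  [NormedSpace ℝ V]

/-- The derivative of `Ω` is Lipschitz near `p₀`, and the mean value inequality on segments turns
this into a uniform quadratic Taylor remainder. -/
theorem exists_uniform_bounds {Ω : E → E →L[ℝ] V →L[ℝ] V} {p₀ : E} {U : Set E} (hU : IsOpen U)
    (hp₀ : p₀ ∈ U) (hΩ : ∀ p ∈ U, ContDiffAt ℝ ∞ Ω p) :
    ∃ C : ℝ, 1 ≤ C ∧ ∃ r > 0, r ≤ 1 ∧ Metric.ball p₀ r ⊆ U ∧ ∀ p ∈ Metric.ball p₀ r,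
      ‖Ω p‖ ≤ C ∧ ‖fderiv ℝ Ω p‖ ≤ C ∧ ∀ q ∈ Metric.ball p₀ r,
        ‖Ω q - Ω p - fderiv ℝ Ω p (q - p)‖ ≤ C * ‖q - p‖ ^ 2 := by
  have hc := (hΩ p₀ hp₀).continuousAt
  have hD : ContDiffAt ℝ ∞ (fderiv ℝ Ω) p₀ := (hΩ p₀ hp₀).fderiv_right (by simp)
  obtain ⟨L, s, hs, hL⟩ := (hD.of_le (m := 1)
    (WithTop.coe_le_coe.2 le_top)).exists_lipschitzOnWith
  have h1 : ∀ᶠ p in 𝓝 p₀, ‖Ω p‖ < ‖Ω p₀‖ + 1 :=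
    hc.norm.eventually (gt_mem_nhds (lt_add_one _))
  have h2 : ∀ᶠ p in 𝓝 p₀, ‖fderiv ℝ Ω p‖ < ‖fderiv ℝ Ω p₀‖ + 1 :=
    hD.continuousAt.norm.eventually (gt_mem_nhds (lt_add_one _))
  obtain ⟨r, hr, hball⟩ := Metric.eventually_nhds_iff_ball.1
    ((h1.and h2).and ((hU.eventually_mem hp₀).and hs))
  refine ⟨max 1 (max (‖Ω p₀‖ + 1) (max (‖fderiv ℝ Ω p₀‖ + 1) L)), le_max_left _ _, min r 1,
    lt_min hr one_pos, min_le_right _ _, fun p hp => ?_, fun p hp => ⟨?_, ?_, fun q hq => ?_⟩⟩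
  · exact (hball p (Metric.ball_subset_ball (min_le_left _ _) hp)).2.1
  · exact (hball p (Metric.ball_subset_ball (min_le_left _ _) hp)).1.1.le.trans
      ((le_max_left _ _).trans (le_max_right _ _))
  · exact (hball p (Metric.ball_subset_ball (min_le_left _ _) hp)).1.2.le.trans
      ((le_max_left _ _).trans ((le_max_right _ _).trans (le_max_right _ _)))
  · have hb : ∀ z ∈ Metric.ball p₀ (min r 1), z ∈ U ∧ z ∈ s := fun z hz =>
      (hball z (Metric.ball_subset_ball (min_le_left _ _) hz)).2
    have hseg : segment ℝ p q ⊆ Metric.ball p₀ (min r 1) :=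
      (convex_ball p₀ _).segment_subset hp hq
    have hmv := (convex_segment p q).norm_image_sub_le_of_norm_hasFDerivWithin_le' (𝕜 := ℝ)
      (f := Ω) (f' := fderiv ℝ Ω) (φ := fderiv ℝ Ω p) (C := L * ‖q - p‖)
      (fun z hz => (hΩ z (hb z (hseg hz)).1).diff.hasFDerivAt.hasFDerivWithinAt)
      (fun z hz => ?_) (left_mem_segment ℝ p q) (right_mem_segment ℝ p q)
    · calc _ ≤ L * ‖q - p‖ * ‖q - p‖ := hmv
        _ = L * ‖q - p‖ ^ 2 := by ring
        _ ≤ _ := by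
          gcongr
          exact (le_max_right _ _).trans ((le_max_right _ _).trans (le_max_right _ _))
    · calc _ ≤ L * ‖z - p‖ := hL.norm_sub_le (hb z (hseg hz)).2 (hb p hp).2
        _ ≤ L * ‖q - p‖ := by
          gcongr
          obtain ⟨θ, hθ, rfl⟩ := (segment_eq_image' ℝ p q ▸ hz : z ∈ _)
          simp only [add_sub_cancel_left, norm_smul, Real.norm_eq_abs, abs_of_nonneg hθ.1]
          exact mul_le_of_le_one_left (norm_nonneg _) hθ.2

/-- The smallness `2 C r ≤ 1` bounds the linear field along the ray by `1/2`. Picard-Lindelöf then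
works on all of `[0, 1]`: on the ball of radius `‖v₀‖ + 1` about `v₀` the speed is at most `‖v₀‖ +
1/2`. Gronwall's inequality gives the growth bound. -/
theorem exists_radial_solution [CompleteSpace V] {Ω : E → E →L[ℝ] V →L[ℝ] V} {p₀ x : E} {C r : ℝ}
    (hC : 1 ≤ C) (hCr : 2 * C * r ≤ 1) (hx : ‖x‖ < r)
    (hΩ : ∀ p ∈ Metric.ball p₀ r, ContinuousAt Ω p ∧ ‖Ω p‖ ≤ C) (v₀ : V) :
    ∃ Z : ℝ → V, Z 0 = v₀ ∧
      (∀ t ∈ Set.Icc (0 : ℝ) 1, HasDerivWithinAt Z (Ω (p₀ + t • x) x (Z t)) (Set.Icc 0 1) t) ∧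
      ∀ t ∈ Set.Icc (0 : ℝ) 1, ‖Z t‖ ≤ ‖v₀‖ * Real.exp 1 := by
  have hmem : ∀ t ∈ Set.Icc (0 : ℝ) 1, p₀ + t • x ∈ Metric.ball p₀ r := fun t ht => by
    rw [mem_ball_iff_norm, add_sub_cancel_left, norm_smul, Real.norm_eq_abs, abs_of_nonneg ht.1]
    exact (mul_le_of_le_one_left (norm_nonneg _) ht.2).trans_lt hx
  have hb : ∀ t ∈ Set.Icc (0 : ℝ) 1, ‖Ω (p₀ + t • x) x‖ ≤ 1 / 2 := fun t ht => by
    refine ((Ω _).le_opNorm x).trans ?_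
    calc _ ≤ C * r := by gcongr; exact (hΩ _ (hmem t ht)).2
      _ ≤ _ := by linarith
  have hP : IsPicardLindelof (fun t z => Ω (p₀ + t • x) x z) (tmin := 0) (tmax := 1)
      ⟨0, by simp⟩ v₀ (‖v₀‖₊ + 1) 0 (‖v₀‖₊ + 1) 1 := by
    refine ⟨fun t ht => ?_, fun z hz => ?_, fun t ht z hz => ?_, by simp⟩
    · refine (ContinuousLinearMap.lipschitz _).lipschitzOnWith.weaken ?_
      rw [← NNReal.coe_le_coe, coe_nnnorm, NNReal.coe_one]
      exact (hb t ht).trans (by norm_num)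
    · intro t ht
      have h1 : ContinuousAt (fun t : ℝ => Ω (p₀ + t • x)) t :=
        ContinuousAt.comp (f := fun t : ℝ => p₀ + t • x) (hΩ _ (hmem t ht)).1 (by fun_prop)
      exact ((h1.clm_apply continuousAt_const).clm_apply continuousAt_const).continuousWithinAt
    · have hz' : ‖z‖ ≤ 2 * ‖v₀‖ + 1 := by
        have := norm_le_norm_add_norm_sub' z v₀
        rw [mem_closedBall_iff_norm] at hz
        push_cast at hz
        linarith
      refine ((Ω (p₀ + t • x) x).le_opNorm z).trans ?_
      push_cast
      calc _ ≤ 1 / 2 * (2 * ‖v₀‖ + 1) := by gcongr; exact hb t ht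
        _ ≤ _ := by linarith
  obtain ⟨Z, h0, hZ⟩ := hP.exists_eq_forall_mem_Icc_hasDerivWithinAt₀
  refine ⟨Z, h0, hZ, fun t ht => ?_⟩
  have hG := norm_le_gronwallBound_of_norm_deriv_right_le (f := Z)
    (f' := fun t => Ω (p₀ + t • x) x (Z t)) (δ := ‖v₀‖) (K := 1) (ε := 0) (a := 0) (b := 1)
    (fun t ht => (hZ t ht).continuousWithinAt)
    (fun t ht => (hZ t (Set.Ico_subset_Icc_self ht)).mono_of_mem_nhdsWithin
      (Icc_mem_nhdsGE_of_mem ht)) (by rw [h0]) (fun t ht => ?_) t ht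
  · refine hG.trans ?_
    rw [gronwallBound_ε0, sub_zero, one_mul]
    gcongr
    exact ht.2
  · refine ((Ω (p₀ + t • x) x).le_opNorm _).trans ?_
    rw [add_zero]
    gcongr
    exact (hb t (Set.Ico_subset_Icc_self ht)).trans (by norm_num)

/-- The defect in the radial differential equation of the first order perturbation of a radial
solution is quadratic. -/
theorem norm_radial_defect_le {A B : E →L[ℝ] V →L[ℝ] V} {D : E →L[ℝ] E →L[ℝ] V →L[ℝ] V}
    {C b t : ℝ} {x h : E} {z : V} (hC : 1 ≤ C) (ht : t ∈ Set.Icc (0 : ℝ) 1) (hA : ‖A‖ ≤ C)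
    (hD : ‖D‖ ≤ C) (hR : ‖B - A - t • D h‖ ≤ C * ‖h‖ ^ 2) (hx : ‖x + h‖ ≤ 1) (hh : ‖h‖ ≤ 2)
    (hz : ‖z‖ ≤ b)
    (hflat : D x h z + A h (A x z) = D h x z + A x (A h z)) :
    ‖(A x z + (A h z + t • (D x h z + A h (A x z)))) - B (x + h) (z + t • A h z)‖ ≤
      6 * C ^ 2 * b * ‖h‖ ^ 2 := by
  have ht1 : ‖t‖ ≤ 1 := by rw [Real.norm_eq_abs, abs_of_nonneg ht.1]; exact ht.2
  have hb0 : 0 ≤ b := (norm_nonneg z).trans hz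
  have hAb : ∀ w u, ‖A w u‖ ≤ C * ‖w‖ * ‖u‖ := fun w u => (A.le_opNorm₂ w u).trans (by gcongr)
  have hDb : ∀ k w u, ‖D k w u‖ ≤ C * ‖k‖ * ‖w‖ * ‖u‖ := fun k w u =>
    ((D k).le_opNorm₂ w u).trans (by gcongr; exact (D.le_opNorm k).trans (by gcongr))
  have hRb : ∀ w u, ‖(B - A - t • D h) w u‖ ≤ C * ‖h‖ ^ 2 * ‖w‖ * ‖u‖ := fun w u =>
    ((B - A - t • D h).le_opNorm₂ w u).trans (by gcongr)
  -- Flatness cancels every term of first order in `h`; the rest is quadratic or the Taylor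
  -- remainder.
  have key : (A x z + (A h z + t • (D x h z + A h (A x z)))) - B (x + h) (z + t • A h z) =
      -(t • A h (A h z) + t • D h h z + t • t • D h (x + h) (A h z) +
        (B - A - t • D h) (x + h) (z + t • A h z)) := by
    rw [hflat]
    simp only [map_add, map_smul, add_apply, sub_apply, smul_apply, smul_add, smul_sub]
    abel
  rw [key, norm_neg]
  have e1 : ‖t • A h (A h z)‖ ≤ C ^ 2 * b * ‖h‖ ^ 2 := by
    rw [norm_smul]
    calc _ ≤ 1 * (C * ‖h‖ * (C * ‖h‖ * b)) := by
          gcongr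
          exact (hAb _ _).trans (by gcongr; exact (hAb _ _).trans (by gcongr))
      _ = _ := by ring
  have e2 : ‖t • D h h z‖ ≤ C ^ 2 * b * ‖h‖ ^ 2 := by
    rw [norm_smul]
    calc _ ≤ 1 * (C * ‖h‖ * ‖h‖ * b) := by
          gcongr
          exact (hDb _ _ _).trans (by gcongr)
      _ = C * 1 * b * ‖h‖ ^ 2 := by ring
      _ ≤ C * C * b * ‖h‖ ^ 2 := by gcongr
      _ = _ := by ring
  have e3 : ‖t • t • D h (x + h) (A h z)‖ ≤ C ^ 2 * b * ‖h‖ ^ 2 := by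
    rw [norm_smul, norm_smul]
    calc _ ≤ 1 * (1 * (C * ‖h‖ * 1 * (C * ‖h‖ * b))) := by
          gcongr
          exact (hDb _ _ _).trans (by gcongr; exact (hAb _ _).trans (by gcongr))
      _ = _ := by ring
  have e4 : ‖(B - A - t • D h) (x + h) (z + t • A h z)‖ ≤ 3 * C ^ 2 * b * ‖h‖ ^ 2 := by
    -- From `‖h‖ ≤ 2` and `1 ≤ C`. This 3, with one for each of the other three terms, makes the
    -- constant 6.
    have : ‖z + t • A h z‖ ≤ 3 * C * b := by
      calc _ ≤ ‖z‖ + ‖t • A h z‖ := norm_add_le _ _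
        _ ≤ b + 1 * (C * 2 * b) := by
          rw [norm_smul]
          gcongr
          exact (hAb _ _).trans (by gcongr)
        _ ≤ C * b + 1 * (C * 2 * b) := by
          gcongr
          exact le_mul_of_one_le_left hb0 hC
        _ = _ := by ring
    calc _ ≤ C * ‖h‖ ^ 2 * 1 * (3 * C * b) := (hRb _ _).trans (by gcongr)
      _ = _ := by ring
  calc _ ≤ ‖t • A h (A h z)‖ + ‖t • D h h z‖ + ‖t • t • D h (x + h) (A h z)‖ +
        ‖(B - A - t • D h) (x + h) (z + t • A h z)‖ := norm_add₄_le
    _ ≤ C ^ 2 * b * ‖h‖ ^ 2 + C ^ 2 * b * ‖h‖ ^ 2 + C ^ 2 * b * ‖h‖ ^ 2 +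
        3 * C ^ 2 * b * ‖h‖ ^ 2 := by gcongr
    _ = _ := by ring

/-- `Y (p₀ + x)` is the time-one value of the solution `Z x` along the ray from `p₀` in direction
`x`. The derivative comes without a theorem on smooth dependence on parameters: by flatness the
explicit first order guess `Z x t + t • Ω (p₀ + t • x) h (Z x t)` solves the equation of the ray `x
+ h` up to `O(‖h‖²)`, and Gronwall's inequality compares it with `Z (x + h)`. -/
theorem exists_hasFDerivAt_of_flat [CompleteSpace V] {Ω : E → E →L[ℝ] V →L[ℝ] V} {p₀ : E}
    {U : Set E} (hU : IsOpen U) (hp₀ : p₀ ∈ U) (hΩ : ∀ p ∈ U, ContDiffAt ℝ ∞ Ω p)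
    (hflat : ∀ p ∈ U, ∀ h k v, fderiv ℝ Ω p k h v + Ω p h (Ω p k v) =
      fderiv ℝ Ω p h k v + Ω p k (Ω p h v)) (v₀ : V) :
    ∃ Y : E → V, Y p₀ = v₀ ∧ ∃ r > 0, Metric.ball p₀ r ⊆ U ∧
      ∀ p ∈ Metric.ball p₀ r, HasFDerivAt Y ((Ω p).flip (Y p)) p := by
  obtain ⟨C, hC, r₀, hr₀, hr₀1, hball, hbd⟩ := exists_uniform_bounds hU hp₀ hΩ
  obtain ⟨r, hr, hrr₀, hCr⟩ : ∃ r > 0, r ≤ r₀ ∧ 2 * C * r ≤ 1 :=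
    ⟨min r₀ (1 / (2 * C)), lt_min hr₀ (by positivity), min_le_left _ _, by
      calc 2 * C * min r₀ (1 / (2 * C)) ≤ 2 * C * (1 / (2 * C)) := by
            gcongr; exact min_le_right _ _
        _ = 1 := by field_simp⟩
  have hsub : Metric.ball p₀ r ⊆ Metric.ball p₀ r₀ := Metric.ball_subset_ball hrr₀
  have hex : ∀ x : E, ∃ Z : ℝ → V, ‖x‖ < r → Z 0 = v₀ ∧
      (∀ t ∈ Set.Icc (0 : ℝ) 1, HasDerivWithinAt Z (Ω (p₀ + t • x) x (Z t)) (Set.Icc 0 1) t) ∧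
      ∀ t ∈ Set.Icc (0 : ℝ) 1, ‖Z t‖ ≤ ‖v₀‖ * Real.exp 1 := by
    intro x
    by_cases hx : ‖x‖ < r
    · obtain ⟨Z, hZ⟩ := exists_radial_solution hC hCr hx
        (fun p hp => ⟨(hΩ p (hball (hsub hp))).continuousAt, (hbd p (hsub hp)).1⟩) v₀
      exact ⟨Z, fun _ => hZ⟩
    · exact ⟨0, fun h => absurd h hx⟩
  choose Z hZ using hex
  have hmem : ∀ x : E, ‖x‖ < r → ∀ t ∈ Set.Icc (0 : ℝ) 1, p₀ + t • x ∈ Metric.ball p₀ r :=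
    fun x hx t ht => by
      rw [mem_ball_iff_norm, add_sub_cancel_left, norm_smul, Real.norm_eq_abs, abs_of_nonneg ht.1]
      exact (mul_le_of_le_one_left (norm_nonneg _) ht.2).trans_lt hx
  set b := ‖v₀‖ * Real.exp 1 with hb
  have key : ∀ x h : E, ‖x‖ < r → ‖x + h‖ < r →
      ‖Z (x + h) 1 - (Z x 1 + Ω (p₀ + x) h (Z x 1))‖ ≤
        6 * C ^ 2 * b * (Real.exp 1 - 1) * ‖h‖ ^ 2 := by
    intro x h hx hxh
    obtain ⟨h0, hd, hn⟩ := hZ x hx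
    obtain ⟨h0', hd', hn'⟩ := hZ (x + h) hxh
    have hh : ‖h‖ ≤ 2 := by
      have : ‖(x + h) - x‖ ≤ ‖x + h‖ + ‖x‖ := norm_sub_le _ _
      rw [add_sub_cancel_left] at this
      linarith
    have hW : ∀ t ∈ Set.Icc (0 : ℝ) 1,
        HasDerivWithinAt (fun t => Z x t + t • Ω (p₀ + t • x) h (Z x t))
        (Ω (p₀ + t • x) x (Z x t) + (Ω (p₀ + t • x) h (Z x t) + t • (fderiv ℝ Ω (p₀ + t • x) x h
          (Z x t) + Ω (p₀ + t • x) h (Ω (p₀ + t • x) x (Z x t))))) (Set.Icc 0 1) t := by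
      intro t ht
      have hl : HasDerivAt (fun t : ℝ => p₀ + t • x) x t := by
        simpa using ((hasDerivAt_id t).smul_const x).const_add p₀
      have hO : HasDerivAt (fun t : ℝ => Ω (p₀ + t • x)) (fderiv ℝ Ω (p₀ + t • x) x) t :=
        ((hΩ _ (hball (hsub (hmem x hx t ht)))).diff.hasFDerivAt).comp_hasDerivAt t hl
      have hO1 := (hO.hasDerivWithinAt (s := Set.Icc 0 1)).clm_apply
        (hasDerivWithinAt_const t (Set.Icc 0 1) h)
      have hO2 := hO1.clm_apply (hd t ht)
      convert! (hd t ht).add ((hasDerivWithinAt_id t (Set.Icc 0 1)).smul hO2) using 1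
      simp
      abel
    -- Both curves start at `v₀`. With Lipschitz constant 1 over unit time, the defect is amplified
    -- by the factor `exp 1 - 1`.
    have hG := dist_le_of_approx_trajectories_ODE_of_mem
      (v := fun t z => Ω (p₀ + t • (x + h)) (x + h) z) (s := fun _ => Set.univ) (K := 1)
      (f := Z (x + h)) (f' := fun t => Ω (p₀ + t • (x + h)) (x + h) (Z (x + h) t))
      (g := fun t => Z x t + t • Ω (p₀ + t • x) h (Z x t))
      (g' := fun t => Ω (p₀ + t • x) x (Z x t) + (Ω (p₀ + t • x) h (Z x t) + t •
        (fderiv ℝ Ω (p₀ + t • x) x h (Z x t) + Ω (p₀ + t • x) h (Ω (p₀ + t • x) x (Z x t)))))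
      (a := 0) (b := 1) (εf := 0) (εg := 6 * C ^ 2 * b * ‖h‖ ^ 2) (δ := 0)
      (fun t ht => ?_) (fun t ht => (hd' t ht).continuousWithinAt)
      (fun t ht => (hd' t (Set.Ico_subset_Icc_self ht)).mono_of_mem_nhdsWithin
        (Icc_mem_nhdsGE_of_mem ht)) (fun t ht => by simp) (fun t ht => trivial)
      (fun t ht => (hW t ht).continuousWithinAt)
      (fun t ht => (hW t (Set.Ico_subset_Icc_self ht)).mono_of_mem_nhdsWithin
        (Icc_mem_nhdsGE_of_mem ht)) (fun t ht => ?_) (fun t ht => trivial) (by simp [h0, h0']) 1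
      (by simp)
    · rw [dist_eq_norm, zero_add, gronwallBound_of_K_ne_0 (by simp)] at hG
      simp only [one_smul] at hG
      refine hG.trans (le_of_eq ?_)
      simp
      ring
    · refine (ContinuousLinearMap.lipschitz _).lipschitzOnWith.weaken ?_
      rw [← NNReal.coe_le_coe, coe_nnnorm, NNReal.coe_one]
      refine ((Ω _).le_opNorm _).trans ?_
      calc _ ≤ C * r := by
            gcongr
            exact (hbd _ (hsub (hmem _ hxh t (Set.Ico_subset_Icc_self ht)))).1
        _ ≤ 1 := by nlinarith
    · have ht' := Set.Ico_subset_Icc_self ht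
      have hq := hbd _ (hsub (hmem _ hx t ht'))
      have hR := hq.2.2 _ (hsub (hmem _ hxh t ht'))
      have hdiff : p₀ + t • (x + h) - (p₀ + t • x) = t • h := by rw [smul_add]; abel
      rw [hdiff, map_smul] at hR
      rw [dist_eq_norm]
      refine norm_radial_defect_le hC ht' hq.1 hq.2.1 (hR.trans ?_) (by linarith) hh (hn t ht')
        (hflat _ (hball (hsub (hmem _ hx t ht'))) h x _)
      gcongr
      rw [norm_smul, Real.norm_eq_abs, abs_of_nonneg ht'.1]
      exact mul_le_of_le_one_left (norm_nonneg _) ht'.2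
  refine ⟨fun p => Z (p - p₀) 1, ?_, r, hr, hsub.trans hball, fun p hp => ?_⟩
  · obtain ⟨h0, hd, -⟩ := hZ (p₀ - p₀) (by simpa using hr)
    -- Along the degenerate ray `x = 0` the field vanishes, so the solution is constant.
    have : Set.EqOn (Z (p₀ - p₀)) (fun _ => v₀) (Set.Icc 0 1) := by
      refine fun t ht => ?_
      refine (constant_of_derivWithin_zero
        (fun t ht => (hd t ht).differentiableWithinAt) (fun t ht => ?_) t ht).trans h0
      rw [(hd t (Set.Ico_subset_Icc_self ht)).derivWithin
        (uniqueDiffOn_Icc one_pos t (Set.Ico_subset_Icc_self ht))]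
      simp
    exact this (by simp)
  · rw [mem_ball_iff_norm] at hp
    have hO : (fun q => Z (q - p₀) 1 - (Z (p - p₀) 1 + (Ω p).flip (Z (p - p₀) 1) (q - p)))
        =O[𝓝 p] fun q => ‖q - p‖ ^ 2 := by
      refine Asymptotics.IsBigO.of_bound (6 * C ^ 2 * b * (Real.exp 1 - 1)) ?_
      have : ∀ᶠ q in 𝓝 p, q ∈ Metric.ball p₀ r :=
        Metric.isOpen_ball.eventually_mem (mem_ball_iff_norm.2 hp)
      filter_upwards [this] with q hq
      rw [mem_ball_iff_norm] at hq
      have hk := key (p - p₀) (q - p) hp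
        (by rw [show p - p₀ + (q - p) = q - p₀ by abel]; exact hq)
      rw [show p - p₀ + (q - p) = q - p₀ by abel, add_sub_cancel] at hk
      rw [norm_pow, norm_norm]
      exact hk
    have h1 := hO.hasFDerivAt (𝕜 := ℝ) (by norm_num)
    have h2 : HasFDerivAt (fun q => Z (p - p₀) 1 + (Ω p).flip (Z (p - p₀) 1) (q - p))
        ((Ω p).flip (Z (p - p₀) 1)) p :=
      (((Ω p).flip (Z (p - p₀) 1)).hasFDerivAt.comp p ((hasFDerivAt_id p).sub_const p)).const_add _
    have h3 := h1.fun_add h2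
    simp only [sub_add_cancel, zero_add] at h3
    exact h3

/-- Bootstrapping: the equation expresses the derivative of `Y` through `Ω` and `Y`, so `Cⁿ`
regularity improves to `Cⁿ⁺¹`. -/
theorem contDiffOn_of_hasFDerivAt_flip {Ω : E → E →L[ℝ] V →L[ℝ] V} {Y : E → V} {s : Set E}
    (hs : IsOpen s) (hΩ : ∀ p ∈ s, ContDiffAt ℝ ∞ Ω p)
    (hY : ∀ p ∈ s, HasFDerivAt Y ((Ω p).flip (Y p)) p) : ContDiffOn ℝ ∞ Y s := by
  have hΩs : ContDiffOn ℝ ∞ Ω s := fun p hp => (hΩ p hp).contDiffWithinAt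
  rw [contDiffOn_infty]
  intro n
  induction n with
  | zero => exact contDiffOn_zero.2 fun p hp => (hY p hp).continuousAt.continuousWithinAt
  | succ n ih =>
    rw [Nat.cast_succ, contDiffOn_succ_iff_fderiv_of_isOpen hs]
    refine ⟨fun p hp => (hY p hp).differentiableAt.differentiableWithinAt, by simp, ?_⟩
    have h1 : ContDiffOn ℝ n (fun p => (Ω p).flip) s :=
      (ContinuousLinearMap.flipₗᵢ ℝ E V V).contDiff.comp_contDiffOn
        (hΩs.of_le (WithTop.coe_le_coe.2 le_top))
    exact (h1.clm_apply ih).congr fun p hp => (hY p hp).fderiv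

end Frobenius

/-! ### Flat linear systems for three functions on the plane. -/

section LinearSystem

set_option maxSynthPendingDepth 3

/-- The constant bilinear map sending `(h, v)` to `hᵢ vₗ` times the `k`-th basis vector. -/
def elementaryForm (i : Fin 2) (k l : Fin 3) : Plane →L[ℝ] (Fin 3 → ℝ) →L[ℝ] (Fin 3 → ℝ) :=
  (EuclideanSpace.proj (𝕜 := ℝ) i : Plane →L[ℝ] ℝ).smulRight
    ((ContinuousLinearMap.proj (R := ℝ) (φ := fun _ : Fin 3 => ℝ) l).smulRight
      (Pi.single k (1 : ℝ) : Fin 3 → ℝ))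

theorem elementaryForm_apply (i : Fin 2) (k l : Fin 3) (h : Plane) (v : Fin 3 → ℝ) (m : Fin 3) :
    elementaryForm i k l h v m = if m = k then h i * v l else 0 := by
  simp [elementaryForm, Pi.single_apply]

theorem sum_elementaryForm_apply (B : Fin 2 → Fin 3 → Fin 3 → ℝ) (h : Plane) (v : Fin 3 → ℝ)
    (m : Fin 3) : (∑ i, ∑ k, ∑ l, B i k l • elementaryForm i k l) h v m =
      ∑ i, ∑ l, B i m l * (h i * v l) := by
  simp only [sum_apply, Finset.sum_apply, smul_apply, Pi.smul_apply, elementaryForm_apply,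
    smul_eq_mul]
  refine Finset.sum_congr rfl fun i _ => ?_
  rw [Fintype.sum_eq_single m fun k hk => by simp [hk.symm]]
  simp

/-- The connection form with coefficients `A`. -/
def connectionForm (A : Fin 2 → Fin 3 → Fin 3 → Plane → ℝ) (p : Plane) :
    Plane →L[ℝ] (Fin 3 → ℝ) →L[ℝ] (Fin 3 → ℝ) :=
  ∑ i, ∑ k, ∑ l, A i k l p • elementaryForm i k l

theorem connectionForm_apply (A : Fin 2 → Fin 3 → Fin 3 → Plane → ℝ) (p h : Plane)
    (v : Fin 3 → ℝ) (m : Fin 3) :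
    connectionForm A p h v m = ∑ i, ∑ l, A i m l p * (h i * v l) :=
  sum_elementaryForm_apply (fun i k l => A i k l p) h v m

variable {A : Fin 2 → Fin 3 → Fin 3 → Plane → ℝ} {p : Plane}

theorem contDiffAt_connectionForm (hA : ∀ i k l, ContDiffAt ℝ ∞ (A i k l) p) :
    ContDiffAt ℝ ∞ (connectionForm A) p :=
  ContDiffAt.sum fun i _ => ContDiffAt.sum fun k _ => ContDiffAt.sum fun l _ =>
    (hA i k l).smul contDiffAt_const

theorem fderiv_connectionForm (hA : ∀ i k l, ContDiffAt ℝ ∞ (A i k l) p) (q h : Plane)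
    (v : Fin 3 → ℝ) (m : Fin 3) :
    fderiv ℝ (connectionForm A) p q h v m =
      ∑ i, ∑ l, (q 0 * partialDeriv 0 (A i m l) p + q 1 * partialDeriv 1 (A i m l) p) *
        (h i * v l) := by
  have h1 : HasFDerivAt (connectionForm A)
      (∑ i, ∑ k, ∑ l, (fderiv ℝ (A i k l) p).smulRight (elementaryForm i k l)) p :=
    HasFDerivAt.fun_sum fun i _ => HasFDerivAt.fun_sum fun k _ => HasFDerivAt.fun_sum fun l _ =>
      (hA i k l).diff.hasFDerivAt.smul_const _
  have h2 : (∑ i, ∑ k, ∑ l, (fderiv ℝ (A i k l) p).smulRight (elementaryForm i k l)) q =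
      ∑ i, ∑ k, ∑ l, fderiv ℝ (A i k l) p q • elementaryForm i k l := by
    simp only [sum_apply, ContinuousLinearMap.smulRight_apply]
  rw [h1.fderiv, h2, sum_elementaryForm_apply (fun i k l => fderiv ℝ (A i k l) p q) h v m]
  simp only [fderiv_eq_partialDeriv]

theorem exists_solution_of_flat {U : Set Plane} {p₀ : Plane} (hU : IsOpen U) (hp₀ : p₀ ∈ U)
    (hA : ∀ p ∈ U, ∀ i k l, ContDiffAt ℝ ∞ (A i k l) p)
    (hflat : ∀ p ∈ U, ∀ k l, partialDeriv 0 (A 1 k l) p + ∑ m, A 1 k m p * A 0 m l p =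
      partialDeriv 1 (A 0 k l) p + ∑ m, A 0 k m p * A 1 m l p) (c : Fin 3 → ℝ) :
    ∃ Y : Fin 3 → Plane → ℝ, (∀ k, Y k p₀ = c k) ∧ ∃ r > 0, Metric.ball p₀ r ⊆ U ∧
      ∀ p ∈ Metric.ball p₀ r, (∀ k, ContDiffAt ℝ ∞ (Y k) p) ∧
        ∀ i k, partialDeriv i (Y k) p = ∑ l, A i k l p * Y l p := by
  obtain ⟨Y, h0, r, hr, hball, hY⟩ := exists_hasFDerivAt_of_flat hU hp₀
    (fun p hp => contDiffAt_connectionForm (hA p hp)) (fun p hp h q v => by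
      ext m
      have hm := hflat p hp m
      simp only [Pi.add_apply, connectionForm_apply, fderiv_connectionForm (hA p hp),
        Fin.sum_univ_two, Fin.sum_univ_three] at hm ⊢
      -- The flatness defect is a 2-form on the plane, hence determined by the pair of indices `(0,
      -- 1)`.
      linear_combination (q 0 * h 1 - q 1 * h 0) * (v 0 * hm 0 + v 1 * hm 1 + v 2 * hm 2)) c
  have hs := contDiffOn_of_hasFDerivAt_flip Metric.isOpen_ball
    (fun p hp => contDiffAt_connectionForm (hA p (hball hp))) hY
  refine ⟨fun k p => Y p k, fun k => congrFun h0 k, r, hr, hball, fun p hp => ⟨fun k => ?_,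
    fun i k => ?_⟩⟩
  · exact contDiffAt_pi.1 (hs.contDiffAt (Metric.isOpen_ball.mem_nhds hp)) k
  · have := hasFDerivAt_pi'.1 (hY p hp) k
    rw [partialDeriv, this.fderiv]
    change connectionForm A p (basisVec i) (Y p) k = _
    rw [connectionForm_apply]
    fin_cases i <;> simp

end LinearSystem

/-! ### Solutions of `∇²σ + K g σ = 0` in constant curvature. -/

section Hessian

variable (g : Metric M) {e : OpenPartialHomeomorph M Plane} {y : Plane} {K : ℝ}

/-- The coefficients of the prolongation of the equation `∇² σ + K g σ = 0`. -/
def prolongation (g : Metric M) (e : OpenPartialHomeomorph M Plane) (K : ℝ) (i : Fin 2)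
    (k l : Fin 3) (y : Plane) : ℝ :=
  !![0, if i = 0 then 1 else 0, if i = 1 then 1 else 0;
    -K * metricCoeff g e y i 0, christoffel g e 0 i 0 y, christoffel g e 1 i 0 y;
    -K * metricCoeff g e y i 1, christoffel g e 0 i 1 y, christoffel g e 1 i 1 y] k l

theorem contDiffAt_prolongation (he : e ∈ IsManifold.maximalAtlas (𝓡 2) ∞ M) (hy : y ∈ e.target)
    (i : Fin 2) (k l : Fin 3) : ContDiffAt ℝ ∞ (prolongation g e K i k l) y := by
  have hG := contDiffAt_metricCoeff g he hy
  have hΓ := contDiffAt_christoffel g he hy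
  fin_cases k <;> fin_cases l
  · exact contDiffAt_const
  · exact contDiffAt_const
  · exact contDiffAt_const
  · exact contDiffAt_const.mul (hG i 0)
  · exact hΓ 0 i 0
  · exact hΓ 1 i 0
  · exact contDiffAt_const.mul (hG i 1)
  · exact hΓ 0 i 1
  · exact hΓ 1 i 1

/-- Row 0 is the symmetry of the metric and of the Christoffel symbols. In the other rows, column 0
is `∇g = 0`, where it matters that `K` is constant, and the remaining four entries are the four
equations `Ric = K g`. -/
theorem prolongation_flat (he : e ∈ IsManifold.maximalAtlas (𝓡 2) ∞ M) (hy : y ∈ e.target)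
    (hK : ∀ i j, ricciCoeff g e i j y = K * metricCoeff g e y i j) (k l : Fin 3) :
    partialDeriv 0 (prolongation g e K 1 k l) y +
        ∑ m, prolongation g e K 1 k m y * prolongation g e K 0 m l y =
      partialDeriv 1 (prolongation g e K 0 k l) y +
        ∑ m, prolongation g e K 0 k m y * prolongation g e K 1 m l y := by
  have hG := contDiffAt_metricCoeff g he hy
  have hM := partialDeriv_metricCoeff g he hy
  have h0 := hK 0
  have h1 := hK 1
  simp only [ricciCoeff_zero, ricciCoeff_one, curvatureCoeff, Fin.sum_univ_two] at h0 h1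
  have hs : ∀ k, christoffel g e k 1 0 = christoffel g e k 0 1 := fun k => by
    ext z; exact christoffel_symm g k 1 0
  have hgs : metricCoeff g e y 1 0 = metricCoeff g e y 0 1 := metricCoeff_symm g 1 0
  have hpr0 : ∀ i l, prolongation g e K i 0 l y =
      ![0, if i = 0 then 1 else 0, if i = 1 then 1 else 0] l := fun _ _ => rfl
  have hpc : ∀ d i l, partialDeriv d (prolongation g e K i 0 l) y = 0 := fun d i l => by
    exact partialDeriv_const d (![0, if i = 0 then 1 else 0, if i = 1 then 1 else 0] l)
  have hp10 : ∀ d i, partialDeriv d (prolongation g e K i 1 0) y =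
    -K * partialDeriv d (fun z => metricCoeff g e z i 0) y := fun d i =>
      partialDeriv_const_mul _ (hG i 0).diff
  have hp20 : ∀ d i, partialDeriv d (prolongation g e K i 2 0) y =
    -K * partialDeriv d (fun z => metricCoeff g e z i 1) y := fun d i =>
      partialDeriv_const_mul _ (hG i 1).diff
  have hp11 : ∀ i, prolongation g e K i 1 1 = christoffel g e 0 i 0 := fun _ => rfl
  have hp12 : ∀ i, prolongation g e K i 1 2 = christoffel g e 1 i 0 := fun _ => rfl
  have hp21 : ∀ i, prolongation g e K i 2 1 = christoffel g e 0 i 1 := fun _ => rfl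
  have hp22 : ∀ i, prolongation g e K i 2 2 = christoffel g e 1 i 1 := fun _ => rfl
  have hv10 : ∀ i, prolongation g e K i 1 0 y = -K * metricCoeff g e y i 0 := fun _ => rfl
  have hv20 : ∀ i, prolongation g e K i 2 0 y = -K * metricCoeff g e y i 1 := fun _ => rfl
  have a0 := h0 0
  have a1 := h0 1
  have b0 := h1 0
  have b1 := h1 1
  simp only [hs, hgs] at a0 a1 b0 b1
  fin_cases k <;> fin_cases l <;>
    simp only [Fin.zero_eta, Fin.mk_one, Fin.reduceFinMk, hpc, hp10, hp20, hp11, hp12, hp21, hp22,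
      hv10, hv20, hpr0, hM, Fin.sum_univ_three, Fin.sum_univ_two, hs, hgs] <;>
    simp
  · ring
  · linear_combination b0
  · linear_combination -a0
  · ring
  · linear_combination b1
  · linear_combination -a1

/-- The unknowns of the linear system are `(σ, ∂₀σ, ∂₁σ)`; its row 0 says that the last two are
indeed the derivatives of the first. -/
theorem exists_hessian_solution (he : e ∈ IsManifold.maximalAtlas (𝓡 2) ∞ M)
    (hK : ∀ z ∈ e.target, ∀ i j, ricciCoeff g e i j z = K * metricCoeff g e z i j)
    (hy : y ∈ e.target) (c : ℝ) (μ : Fin 2 → ℝ) :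
    ∃ σ : Plane → ℝ, σ y = c ∧ (∀ i, partialDeriv i σ y = μ i) ∧ ∃ r > 0,
      Metric.ball y r ⊆ e.target ∧ ∀ p ∈ Metric.ball y r, ContDiffAt ℝ ∞ σ p ∧
        ∀ i j, partialDeriv i (partialDeriv j σ) p =
          ∑ k : Fin 2, christoffel g e k i j p * partialDeriv k σ p -
            K * metricCoeff g e p i j * σ p := by
  obtain ⟨Y, h0, r, hr, hball, hY⟩ := exists_solution_of_flat e.open_target hy
    (fun p hp i k l => contDiffAt_prolongation g he hp i k l)
    (fun p hp => prolongation_flat g he hp (hK p hp)) ![c, μ 0, μ 1]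
  have hd0 : ∀ p ∈ Metric.ball y r, partialDeriv 0 (Y 0) p = Y 1 p := fun p hp => by
    rw [(hY p hp).2 0 0, Fin.sum_univ_three]; simp [prolongation]
  have hd1 : ∀ p ∈ Metric.ball y r, partialDeriv 1 (Y 0) p = Y 2 p := fun p hp => by
    rw [(hY p hp).2 1 0, Fin.sum_univ_three]; simp [prolongation]
  have hyb : y ∈ Metric.ball y r := Metric.mem_ball_self hr
  refine ⟨Y 0, h0 0, fun i => ?_, r, hr, hball, fun p hp => ⟨(hY p hp).1 0, fun i j => ?_⟩⟩
  · fin_cases i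
    · exact (hd0 y hyb).trans (h0 1)
    · exact (hd1 y hyb).trans (h0 2)
  · have hbn := Metric.isOpen_ball.mem_nhds hp
    rw [Fin.sum_univ_two, hd0 p hp, hd1 p hp]
    fin_cases j
    · rw [Fin.zero_eta, partialDeriv_congr (eventually_of_mem hbn hd0), (hY p hp).2 i 1,
        Fin.sum_univ_three]
      simp [prolongation]
      ring
    · rw [Fin.mk_one, partialDeriv_congr (eventually_of_mem hbn hd1), (hY p hp).2 i 2,
        Fin.sum_univ_three]
      simp [prolongation]
      ring

end Hessian

/-! ### Uniqueness for second order linear equations on an interval. -/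

section LinearODE

theorem eq_zero_of_second_order_linear {s : Set ℝ} (hs : IsPreconnected s) {u w q f : ℝ → ℝ}
    (hq : ContinuousOn q s) (hf : ContinuousOn f s) (hu : ∀ t ∈ s, HasDerivAt u (w t) t)
    (hw : ∀ t ∈ s, HasDerivAt w (q t * u t + f t * w t) t) {t₀ : ℝ} (ht₀ : t₀ ∈ s)
    (hu0 : u t₀ = 0) (hw0 : w t₀ = 0) : ∀ t ∈ s, u t = 0 := by
  intro t₁ ht₁
  -- The coefficients may be unbounded on `s`, so a Lipschitz constant is sought only between `t₀`
  -- and `t₁`.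
  have hsub : Set.uIcc t₀ t₁ ⊆ s := hs.ordConnected.uIcc_subset ht₀ ht₁
  obtain ⟨C, hC⟩ := isCompact_uIcc.exists_bound_of_continuousOn (hq.mono hsub)
  obtain ⟨D, hD⟩ := isCompact_uIcc.exists_bound_of_continuousOn (hf.mono hsub)
  let v : ℝ → ℝ × ℝ → ℝ × ℝ := fun t z => (z.2, q t * z.1 + f t * z.2)
  have hlip : ∀ t ∈ Set.uIcc t₀ t₁,
      LipschitzOnWith (Real.toNNReal (1 + |C| + |D|)) (v t) Set.univ := by
    intro t ht
    refine LipschitzOnWith.of_dist_le_mul fun z _ z' _ => ?_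
    rw [Real.coe_toNNReal _ (by positivity), dist_eq_norm, dist_eq_norm]
    have h1 : |(z - z').1| ≤ ‖z - z'‖ := norm_fst_le (z - z')
    have h2 : |(z - z').2| ≤ ‖z - z'‖ := norm_snd_le (z - z')
    have hv : v t z - v t z' = ((z - z').2, q t * (z - z').1 + f t * (z - z').2) := by
      simp only [v, Prod.mk_sub_mk, Prod.fst_sub, Prod.snd_sub, Prod.mk.injEq, true_and]
      ring
    have hn := norm_nonneg (z - z')
    rw [hv, Prod.norm_mk, max_le_iff]
    constructor
    · rw [Real.norm_eq_abs]
      nlinarith [abs_nonneg C, abs_nonneg D]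
    · calc _ ≤ ‖q t‖ * |(z - z').1| + ‖f t‖ * |(z - z').2| := by
            refine (norm_add_le _ _).trans ?_
            rw [norm_mul, norm_mul, Real.norm_eq_abs (z - z').1, Real.norm_eq_abs (z - z').2]
        _ ≤ |C| * ‖z - z'‖ + |D| * ‖z - z'‖ := by
            gcongr
            · exact (hC t ht).trans (le_abs_self C)
            · exact (hD t ht).trans (le_abs_self D)
        _ ≤ _ := by nlinarith
  have hF : ∀ t ∈ Set.uIcc t₀ t₁, HasDerivAt (fun t => (u t, w t)) (v t (u t, w t)) t :=
    fun t ht => (hu t (hsub ht)).prodMk (hw t (hsub ht))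
  have hZ : ∀ t, HasDerivAt (fun _ : ℝ => ((0, 0) : ℝ × ℝ)) (v t (0, 0)) t := fun t => by
    have h0 : v t (0, 0) = 0 := by simp [v]
    rw [h0]
    exact hasDerivAt_const t _
  have hini : (u t₀, w t₀) = ((0, 0) : ℝ × ℝ) := by rw [hu0, hw0]
  have key : (u t₁, w t₁) = ((0, 0) : ℝ × ℝ) := by
    rcases le_total t₀ t₁ with hle | hle
    · rw [Set.uIcc_of_le hle] at hlip hF
      exact ODE_solution_unique_of_mem_Icc_right (v := v) (s := fun _ => Set.univ)
        (fun t ht => hlip t (Set.Ico_subset_Icc_self ht))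
        (fun t ht => (hF t ht).continuousAt.continuousWithinAt)
        (fun t ht => (hF t (Set.Ico_subset_Icc_self ht)).hasDerivWithinAt) (fun _ _ => trivial)
        continuousOn_const (fun t _ => (hZ t).hasDerivWithinAt) (fun _ _ => trivial) hini
        (Set.right_mem_Icc.2 hle)
    · rw [Set.uIcc_of_ge hle] at hlip hF
      exact ODE_solution_unique_of_mem_Icc_left (v := v) (s := fun _ => Set.univ)
        (fun t ht => hlip t (Set.Ioc_subset_Icc_self ht))
        (fun t ht => (hF t ht).continuousAt.continuousWithinAt)
        (fun t ht => (hF t (Set.Ioc_subset_Icc_self ht)).hasDerivWithinAt) (fun _ _ => trivial)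
        continuousOn_const (fun t _ => (hZ t).hasDerivWithinAt) (fun _ _ => trivial) hini
        (Set.left_mem_Icc.2 hle)
  exact congrArg Prod.fst key

end LinearODE

/-! ### Solutions of the Hessian equation along geodesics. -/

section HessianAlongCurve

variable (g : Metric M) {e : OpenPartialHomeomorph M Plane} {γ : ℝ → M} {t : ℝ} {σ : Plane → ℝ}
  {K : ℝ}

/-- The derivative of `σ ∘ e ∘ γ` in terms of the components of the velocity of `γ`. -/
def derivAlong (e : OpenPartialHomeomorph M Plane) (γ : ℝ → M) (σ : Plane → ℝ) (t : ℝ) : ℝ :=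
  ∑ k : Fin 2, partialDeriv k σ (e (γ t)) * velocityCoeff e γ k t

theorem hasDerivAt_comp_curve (hs : DifferentiableAt ℝ (fun τ => e (γ τ)) t)
    (hσ : DifferentiableAt ℝ σ (e (γ t))) :
    HasDerivAt (fun τ => σ (e (γ τ))) (derivAlong e γ σ t) t := by
  have h1 : DifferentiableAt ℝ (fun τ => σ (e (γ τ))) t := hσ.comp t hs
  have h2 := deriv_comp_curve hσ hs
  exact h1.hasDerivAt.congr_deriv h2

/-- This is `(σ ∘ γ)'' = ∇²σ(U, U) + dσ(∇_U U)`: the Hessian equation turns the first term into a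
multiple of `σ`, and the geodesic equation turns the second into `f` times the first derivative. -/
theorem hasDerivAt_derivAlong (hs : ContDiffAt ℝ ∞ (fun τ => e (γ τ)) t)
    (hσ : ContDiffAt ℝ ∞ σ (e (γ t)))
    (hess : ∀ i j, partialDeriv i (partialDeriv j σ) (e (γ t)) =
      ∑ k : Fin 2, christoffel g e k i j (e (γ t)) * partialDeriv k σ (e (γ t)) -
        K * metricCoeff g e (e (γ t)) i j * σ (e (γ t)))
    {f : ℝ} (hf : ∀ k, accelerationCoeff g e γ k t = f * velocityCoeff e γ k t) :
    HasDerivAt (derivAlong e γ σ)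
      ((-K * ∑ i : Fin 2, ∑ j : Fin 2, metricCoeff g e (e (γ t)) i j * velocityCoeff e γ i t *
        velocityCoeff e γ j t) * σ (e (γ t)) + f * derivAlong e γ σ t) t := by
  have hV := fun k => (contDiffAt_velocityCoeff hs k).diff.hasDerivAt
  have hP := fun k => hasDerivAt_comp_curve hs.diff (contDiffAt_partialDeriv hσ k).diff
  have h := HasDerivAt.fun_sum (u := (Finset.univ : Finset (Fin 2)))
    fun k _ => (hP k).fun_mul (hV k)
  refine h.congr_deriv ?_
  have h0 := hf 0
  have h1 := hf 1
  simp only [derivAlong, hess]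
  simp only [accelerationCoeff, Fin.sum_univ_two] at h0 h1 ⊢
  linear_combination partialDeriv 0 σ (e (γ t)) * h0 + partialDeriv 1 σ (e (γ t)) * h1

end HessianAlongCurve

/-! ### Linear relations and collinearity. -/

section Collinear

theorem collinear_of_linear_eq {S : Set Plane} {a b d : ℝ} (hab : a ≠ 0 ∨ b ≠ 0)
    (h : ∀ p ∈ S, a * p 0 + b * p 1 = d) : Collinear ℝ S := by
  rcases S.eq_empty_or_nonempty with rfl | ⟨p₀, hp₀⟩
  · exact collinear_empty ℝ _
  rw [collinear_iff_of_mem hp₀]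
  have hn : a ^ 2 + b ^ 2 ≠ 0 := by
    rcases hab with h | h <;> positivity
  refine ⟨!₂[-b, a], fun p hp => ⟨(a * (p 1 - p₀ 1) - b * (p 0 - p₀ 0)) / (a ^ 2 + b ^ 2), ?_⟩⟩
  have e1 := h p hp
  have e2 := h p₀ hp₀
  ext i
  fin_cases i
  · simp
    field_simp
    linear_combination a * e1 - a * e2
  · simp
    field_simp
    linear_combination b * e1 - b * e2

/-- The three vectors `(uᵢ, wᵢ)` of the plane are dependent. Since `u 0 ≠ 0`, the coefficient `a` is
determined by `b` and `c`, so a nontrivial relation has `(b, c) ≠ 0`; this makes it the equation of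
a genuine line. -/
theorem exists_relation {u w : Fin 3 → ℝ} (hu : u 0 ≠ 0) :
    ∃ a b c : ℝ, (b ≠ 0 ∨ c ≠ 0) ∧ a * u 0 + b * u 1 + c * u 2 = 0 ∧
      a * w 0 + b * w 1 + c * w 2 = 0 := by
  have key : ∀ b c : ℝ, b * (w 1 * u 0 - w 0 * u 1) + c * (w 2 * u 0 - w 0 * u 2) = 0 →
      ∃ a, a * u 0 + b * u 1 + c * u 2 = 0 ∧ a * w 0 + b * w 1 + c * w 2 = 0 := by
    intro b c h
    refine ⟨-(b * u 1 + c * u 2) / u 0, by field_simp; ring, ?_⟩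
    field_simp
    linear_combination h
  by_cases h : w 1 * u 0 - w 0 * u 1 = 0
  · obtain ⟨a, ha⟩ := key 1 0 (by rw [h]; ring)
    exact ⟨a, 1, 0, by simp, ha⟩
  · obtain ⟨a, ha⟩ := key (w 2 * u 0 - w 0 * u 2) (-(w 1 * u 0 - w 0 * u 1)) (by ring)
    exact ⟨a, _, _, Or.inr (neg_ne_zero.2 h), ha⟩

end Collinear

/-! ### New charts from the inverse function theorem. -/

section ChartChange

theorem exists_mem_contDiffGroupoid {Ψ : Plane → Plane} {W : Set Plane} (hW : IsOpen W)
    {y : Plane} (hy : y ∈ W) (hΨ : ∀ z ∈ W, ContDiffAt ℝ ∞ Ψ z)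
    (hd : HasFDerivAt Ψ (ContinuousLinearMap.id ℝ Plane) y) :
    ∃ R : OpenPartialHomeomorph Plane Plane, y ∈ R.source ∧ R.source ⊆ W ∧ ⇑R = Ψ ∧
      R ∈ contDiffGroupoid ∞ (𝓡 2) := by
  let R₀ := (hΨ y hy).toOpenPartialHomeomorph Ψ (f' := ContinuousLinearEquiv.refl ℝ Plane) hd
    (by simp)
  -- The inverse must be smooth on the whole target, so the domain is shrunk to points where the
  -- derivative is invertible.
  have hinv : ∀ᶠ z in 𝓝 y, fderiv ℝ Ψ z ∈
      Set.range ((↑) : (Plane ≃L[ℝ] Plane) → (Plane →L[ℝ] Plane)) := by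
    have hc : ContinuousAt (fderiv ℝ Ψ) y :=
      ((hΨ y hy).fderiv_right (m := ∞) (by simp)).continuousAt
    refine hc.eventually (ContinuousLinearEquiv.isOpen.mem_nhds ?_)
    exact ⟨ContinuousLinearEquiv.refl ℝ Plane, hd.fderiv.symm⟩
  obtain ⟨N, hNsub, hNo, hyN⟩ := eventually_nhds_iff.1 (hinv.and (hW.eventually_mem hy))
  have hRy : y ∈ R₀.source := (hΨ y hy).mem_toOpenPartialHomeomorph_source
    (f' := ContinuousLinearEquiv.refl ℝ Plane) hd (by simp)
  refine ⟨R₀.restrOpen N hNo, ⟨hRy, hyN⟩, fun z hz => (hNsub z hz.2).2, rfl, ?_⟩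
  rw [contDiffGroupoid, mem_groupoid_of_pregroupoid]
  constructor
  · rw [contDiffPregroupoid]
    intro z hz
    have hz1 : z ∈ (R₀.restrOpen N hNo).source := hz.1
    exact (hΨ z (hNsub z hz1.2).2).contDiffWithinAt
  · rw [contDiffPregroupoid]
    intro z hz
    have hz1 : z ∈ (R₀.restrOpen N hNo).target := hz.1
    have hz2 := (R₀.restrOpen N hNo).map_target hz1
    obtain ⟨⟨L, hL⟩, hzW⟩ := hNsub _ hz2.2
    have hz3 := hΨ _ hzW
    have := (R₀.restrOpen N hNo).contDiffAt_symm (f₀' := L) hz1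
      (hL ▸ hz3.diff.hasFDerivAt) hz3
    exact this.contDiffWithinAt

theorem trans_mem_maximalAtlas {φ : OpenPartialHomeomorph M Plane}
    {R : OpenPartialHomeomorph Plane Plane} (hφ : φ ∈ IsManifold.maximalAtlas (𝓡 2) ∞ M)
    (hR : R ∈ contDiffGroupoid ∞ (𝓡 2)) : φ.trans R ∈ IsManifold.maximalAtlas (𝓡 2) ∞ M := by
  intro e' he'
  obtain ⟨h1, h2⟩ := hφ e' he'
  refine ⟨?_, ?_⟩
  · rw [OpenPartialHomeomorph.trans_symm_eq_symm_trans_symm, OpenPartialHomeomorph.trans_assoc]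
    exact StructureGroupoid.trans _ (StructureGroupoid.symm _ hR) h1
  · rw [← OpenPartialHomeomorph.trans_assoc]
    exact StructureGroupoid.trans _ h2 hR

end ChartChange

/-! ### The straightening chart `(σ₁/σ₀, σ₂/σ₀)`. -/

section Straightening

variable (g : Metric M)

theorem exists_straightening_chart {φ : OpenPartialHomeomorph M Plane} {K : ℝ}
    (hφ : φ ∈ IsManifold.maximalAtlas (𝓡 2) ∞ M)
    (hK : ∀ z ∈ φ.target, ∀ i j, ricciCoeff g φ i j z = K * metricCoeff g φ z i j) {x : M}
    (hx : x ∈ φ.source) : ∃ e ∈ IsManifold.maximalAtlas (𝓡 2) ∞ M,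
      x ∈ e.source ∧ GeodesicsBecomeStraight g e := by
  have hy := φ.map_source hx
  obtain ⟨σ₀, h0, hd0, r₀, hr₀, hb₀, hs₀⟩ :=
    exists_hessian_solution g hφ hK hy 1 (fun _ => 0)
  obtain ⟨σ₁, h1, hd1, r₁, hr₁, hb₁, hs₁⟩ :=
    exists_hessian_solution g hφ hK hy 0 (fun i => if i = 0 then 1 else 0)
  obtain ⟨σ₂, h2, hd2, r₂, hr₂, hb₂, hs₂⟩ :=
    exists_hessian_solution g hφ hK hy 0 (fun i => if i = 1 then 1 else 0)
  have hne : ∀ᶠ z in 𝓝 (φ x), σ₀ z ≠ 0 :=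
    (hs₀ _ (Metric.mem_ball_self hr₀)).1.continuousAt.eventually_ne (by rw [h0]; exact one_ne_zero)
  obtain ⟨N, hN, hNo, hyN⟩ := eventually_nhds_iff.1 (hne.and
    ((Metric.isOpen_ball.eventually_mem (Metric.mem_ball_self hr₀)).and
      ((Metric.isOpen_ball.eventually_mem (Metric.mem_ball_self hr₁)).and
        (Metric.isOpen_ball.eventually_mem (Metric.mem_ball_self hr₂)))))
  have hσ : ∀ z ∈ N, σ₀ z ≠ 0 ∧ ContDiffAt ℝ ∞ σ₀ z ∧ ContDiffAt ℝ ∞ σ₁ z ∧ ContDiffAt ℝ ∞ σ₂ z :=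
    fun z hz => ⟨(hN z hz).1, (hs₀ z (hN z hz).2.1).1, (hs₁ z (hN z hz).2.2.1).1,
      (hs₂ z (hN z hz).2.2.2).1⟩
  let Ψ : Plane → Plane := fun z => !₂[σ₁ z / σ₀ z, σ₂ z / σ₀ z]
  have hΨ : ∀ z ∈ N, ContDiffAt ℝ ∞ Ψ z := by
    intro z hz
    obtain ⟨hn, c0, c1, c2⟩ := hσ z hz
    rw [contDiffAt_euclidean]
    intro i
    fin_cases i
    · exact c1.div c0 hn
    · exact c2.div c0 hn
  have hdΨ : HasFDerivAt Ψ (ContinuousLinearMap.id ℝ Plane) (φ x) := by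
    obtain ⟨hn, c0, c1, c2⟩ := hσ _ hyN
    -- Where `τ = 0` and `σ₀ = 1`, the differential of `τ/σ₀` is `dτ`; the chosen jets thus give `Ψ`
    -- the identity as derivative at the base point.
    have hquot : ∀ {τ : Plane → ℝ} (v : Plane), ContDiffAt ℝ ∞ τ (φ x) → τ (φ x) = 0 →
        fderiv ℝ (fun z => τ z / σ₀ z) (φ x) v = fderiv ℝ τ (φ x) v := by
      intro τ v hτ hτ0
      have hm : (fun z => (τ z / σ₀ z) * σ₀ z) =ᶠ[𝓝 (φ x)] τ :=
        hne.mono fun z hz => div_mul_cancel₀ _ hz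
      have hdv : DifferentiableAt ℝ (fun z => τ z / σ₀ z) (φ x) := (hτ.div c0 hn).diff
      rw [← hm.fderiv_eq, fderiv_fun_mul hdv c0.diff]
      simp [hτ0, h0]
    have : fderiv ℝ Ψ (φ x) = ContinuousLinearMap.id ℝ Plane := by
      ext v i
      rw [← fderiv_coord (hΨ _ hyN).diff v i]
      fin_cases i
      · change fderiv ℝ (fun z => σ₁ z / σ₀ z) (φ x) v = v 0
        rw [hquot v c1 h1, fderiv_eq_partialDeriv, hd1, hd1]
        simp
      · change fderiv ℝ (fun z => σ₂ z / σ₀ z) (φ x) v = v 1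
        rw [hquot v c2 h2, fderiv_eq_partialDeriv, hd2, hd2]
        simp
    exact this ▸ (hΨ _ hyN).diff.hasFDerivAt
  obtain ⟨R, hyR, hRN, hRΨ, hR⟩ := exists_mem_contDiffGroupoid hNo hyN hΨ hdΨ
  refine ⟨φ.trans R, trans_mem_maximalAtlas hφ hR, ⟨hx, hyR⟩, ?_⟩
  intro γ s hso hsp hγ hmaps
  rcases s.eq_empty_or_nonempty with rfl | ⟨t₀, ht₀⟩
  · simpa using collinear_empty ℝ Plane
  have hsrc : ∀ t ∈ s, γ t ∈ φ.source := fun t ht => (hmaps ht).1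
  have hmem : ∀ t ∈ s, φ (γ t) ∈ N := fun t ht => hRN (hmaps ht).2
  have hc : ∀ t ∈ s, ContDiffAt ℝ ∞ (fun τ => φ (γ τ)) t := fun t ht =>
    contMDiffAt_iff_contDiffAt.1 ((contMDiffAt_of_mem_maximalAtlas hφ (hsrc t ht)).comp t
      (hγ.smooth.contMDiffAt (hso.mem_nhds ht)))
  obtain ⟨f, hf, hacc⟩ := hγ.accel
  let q : ℝ → ℝ := fun t => -K * ∑ i : Fin 2, ∑ j : Fin 2, metricCoeff g φ (φ (γ t)) i j *
    velocityCoeff φ γ i t * velocityCoeff φ γ j t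
  have hq : ContinuousOn q s := by
    intro t ht
    have hG : ∀ i j, ContinuousAt (fun τ => metricCoeff g φ (φ (γ τ)) i j) t := fun i j =>
      ContinuousAt.comp (f := fun τ => φ (γ τ))
        (contDiffAt_metricCoeff g hφ (φ.map_source (hsrc t ht)) i j).continuousAt
        (hc t ht).continuousAt
    have hV := fun k => (contDiffAt_velocityCoeff (hc t ht) k).continuousAt
    have : ContinuousAt q t := by
      refine continuousAt_const.mul ?_
      simp only [Fin.sum_univ_two]
      exact ((((hG 0 0).mul (hV 0)).mul (hV 0)).add (((hG 0 1).mul (hV 0)).mul (hV 1))).add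
        ((((hG 1 0).mul (hV 1)).mul (hV 0)).add (((hG 1 1).mul (hV 1)).mul (hV 1)))
    exact this.continuousWithinAt
  -- The relation is chosen among the initial data at `t₀`; uniqueness for the common second order
  -- equation spreads it over all of `s`.
  obtain ⟨a, b, c, hbc, hu, hw⟩ := exists_relation
    (u := ![σ₀ (φ (γ t₀)), σ₁ (φ (γ t₀)), σ₂ (φ (γ t₀))])
    (w := ![derivAlong φ γ σ₀ t₀, derivAlong φ γ σ₁ t₀, derivAlong φ γ σ₂ t₀])
    (hσ _ (hmem t₀ ht₀)).1
  have hzero := eq_zero_of_second_order_linear hsp hq hf.continuousOn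
    (u := fun t => a * σ₀ (φ (γ t)) + b * σ₁ (φ (γ t)) + c * σ₂ (φ (γ t)))
    (w := fun t => a * derivAlong φ γ σ₀ t + b * derivAlong φ γ σ₁ t + c * derivAlong φ γ σ₂ t)
    (fun t ht => by
      obtain ⟨hn, c0, c1, c2⟩ := hσ _ (hmem t ht)
      exact (((hasDerivAt_comp_curve (hc t ht).diff c0.diff).const_mul a).add
        ((hasDerivAt_comp_curve (hc t ht).diff c1.diff).const_mul b)).add
        ((hasDerivAt_comp_curve (hc t ht).diff c2.diff).const_mul c))
    (fun t ht => by
      obtain ⟨hn, c0, c1, c2⟩ := hσ _ (hmem t ht)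
      have hN' := (hN _ (hmem t ht)).2
      have ha := fun k => hacc t ht φ hφ (hsrc t ht) k
      have H := (((hasDerivAt_derivAlong g (hc t ht) c0 (hs₀ _ hN'.1).2 ha).const_mul a).add
        ((hasDerivAt_derivAlong g (hc t ht) c1 (hs₁ _ hN'.2.1).2 ha).const_mul b)).add
        ((hasDerivAt_derivAlong g (hc t ht) c2 (hs₂ _ hN'.2.2).2 ha).const_mul c)
      refine H.congr_deriv ?_
      simp only [q]
      ring) ht₀ hu hw
  refine collinear_of_linear_eq hbc (d := -a) ?_
  rintro _ ⟨t, ht, rfl⟩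
  have hn := (hσ _ (hmem t ht)).1
  have hz := hzero t ht
  change b * (R (φ (γ t))) 0 + c * (R (φ (γ t))) 1 = -a
  rw [hRΨ]
  change b * (σ₁ (φ (γ t)) / σ₀ (φ (γ t))) + c * (σ₂ (φ (γ t)) / σ₀ (φ (γ t))) = -a
  field_simp
  linear_combination hz

theorem straight_of_hasConstantCurvature (h : HasConstantCurvature g) (x : M) :
    ∃ e ∈ IsManifold.maximalAtlas (𝓡 2) ∞ M, x ∈ e.source ∧ GeodesicsBecomeStraight g e := by
  obtain ⟨K, hK⟩ := h
  have hφ := IsManifold.chart_mem_maximalAtlas (I := 𝓡 2) (n := ∞) x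
  refine exists_straightening_chart g (K := K) hφ (fun z hz i j => ?_) (mem_chart_source Plane x)
  have := hK _ _ hφ ((chartAt Plane x).map_target hz) i j
  rwa [(chartAt Plane x).right_inv hz] at this

end Straightening

end Beltrami

end

theorem mainTheorem2 {M : Type*} [TopologicalSpace M]
    [ChartedSpace (EuclideanSpace ℝ (Fin 2)) M] [IsManifold (𝓡 2) ∞ M] [PreconnectedSpace M]
    (g : Bundle.ContMDiffRiemannianMetric (𝓡 2) ∞ (EuclideanSpace ℝ (Fin 2))
      (fun x : M => TangentSpace (𝓡 2) x)) :
    Beltrami.HasConstantCurvature g ↔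
      ∀ x : M, ∃ e ∈ IsManifold.maximalAtlas (𝓡 2) ∞ M,
        x ∈ e.source ∧ Beltrami.GeodesicsBecomeStraight g e :=
  ⟨Beltrami.straight_of_hasConstantCurvature g, Beltrami.hasConstantCurvature_of_straight g⟩
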